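/- Let $\mathcal H$ be a complex Hilbert space with a complete orthonormal system $\{|n\rangle\}_{n\in\mathbb N}$, $\mathbb N=\{0,1,2,\dots\}$, let $\mathcal L(\mathcal H)$ be the bounded operators on $\mathcal H$, and let $\lambda,t>0$. Define $$p^{\mathrm{pc}}(m|n)=\binom{n}{m}(1-e^{-\lambda t})^m e^{-\lambda t(n-m)},\qquad M^{\mathrm{pc}}_m=\sum_{n=0}^\infty\sqrt{p^{\mathrm{pc}}(m|m+n)}\,|n\rangle\langle n+m|,$$ $$p^{\mathrm{qc}}(m|n)=\binom{n+m}{m}(e^{\lambda t}-1)^m e^{-\lambda t(n+m+1)},\qquad M^{\mathrm{qc}}_m=\sum_{n=0}^\infty\sqrt{p^{\mathrm{qc}}(m|n)}\,|n+m\rangle\langle n|,$$ and, for $\mathrm{x}\in\{\mathrm{pc},\mathrm{qc}\}$, the completely positive instrument $\mathcal I^{\mathrm x}_B(b)=\sum_{m\in B}(M^{\mathrm x}_m)^*\,b\,M^{\mathrm x}_m$ ($B\subseteq\mathbb N$, $b\in\mathcal L(\mathcal H)$), with outcome space $\mathbb N$ (the photon counting and the quantum counter instrument). Sums and integrals of operators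 are taken in the weak operator topology. A POVM on a measurable space $\Omega$ is a positive, normalized map from the measurable sets to $\mathcal L(\mathcal H)$ that is countably additive in the weak operator topology. For POVMs $E^1,E^2$ on $\Omega_1,\Omega_2$ write $E^1\preceq E^2$ if there is a Markov kernel $\nu$ from $\Omega_2$ to $\Omega_1$ with $E^1(B)=\int_{\Omega_2}\nu_\omega(B)\,E^2(d\omega)$ for all measurable $B\subseteq\Omega_1$, and $E^1\simeq E^2$ if $E^1\preceq E^2$ and $E^2\preceq E^1$. Put $E^N(B)=\sum_{n\in B}|n\rangle\langle n|$ for $B\subseteq\mathbb N$, and $E^X(B)=\int_B F_x\,dx$ with $F_x=\sum_{n\in\mathbb N}\frac{e^{-x}x^n}{n!}|n\rangle\langle n|$ for Borel sets $B\subseteq(0,\infty)$. Then for $\mathrm x\in\{\mathrm{pc},\mathrm{qc}\}$ there is a unique POVM $E^{\mathrm x}_\infty$ on the product space $\mathbb N^\infty$, the infinite composition of $\mathcal I^{\mathrm x}$, such that $$E^{\mathrm x}_\infty(B_1\times\cdots\times B_n\times\mathbb N^\infty)=\mathcal I^{\mathrm x}_{B_1}\circ\cdots\circ\mathcal I^{\mathrm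 x}_{B_n}(I)\qquad(n\ge1,\ B_1,\dots,B_n\subseteq\mathbb N),$$ and (1) $E^{\mathrm{pc}}_\infty\simeq E^N$; (2) $E^{\mathrm{qc}}_\infty\simeq E^X$. -/

import Mathlib

namespace PhotonMeasurement

open MeasureTheory ProbabilityTheory
open scoped InnerProductSpace ComplexOrder

set_option linter.unusedSectionVars false

noncomputable section

section Weak

variable {H : Type*} [NormedAddCommGroup H] [InnerProductSpace ℂ H]

/-- The sum `∑ᵢ Aᵢ` of a family of bounded operators in the weak operator topology. -/
def wotSum {ι : Type*} (A : ι → H →L[ℂ] H) : H →L[ℂ] H :=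
  (∑' i, ContinuousLinearMapWOT.ofCLM (A i)).toCLM

/-- `T = ∫ F dμ` in the weak operator topology. -/
def IsWeakIntegral {α : Type*} [MeasurableSpace α] (μ : Measure α) (F : α → H →L[ℂ] H)
    (T : H →L[ℂ] H) : Prop :=
  ∀ x y, Integrable (fun s => ⟪x, F s y⟫_ℂ) μ ∧ ⟪x, T y⟫_ℂ = ∫ s, ⟪x, F s y⟫_ℂ ∂μ

open Classical in
/-- The integral `∫ F dμ` of an operator valued function in the weak operator topology
(with the value `0` if it does not exist). -/
def weakIntegral {α : Type*} [MeasurableSpace α] (μ : Measure α) (F : α → H →L[ℂ] H) :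
    H →L[ℂ] H :=
  if h : ∃ T, IsWeakIntegral μ F T then h.choose else 0

theorem isWeakIntegral_weakIntegral {α : Type*} [MeasurableSpace α] {μ : Measure α}
    {F : α → H →L[ℂ] H} (h : ∃ T, IsWeakIntegral μ F T) :
    IsWeakIntegral μ F (weakIntegral μ F) := by
  rw [weakIntegral, dif_pos h]
  exact h.choose_spec

theorem cauchySchwarz_tsum {ι : Type*} {a b : ι → ℝ} (ha : ∀ i, 0 ≤ a i) (hb : ∀ i, 0 ≤ b i)
    {A B : ℝ} (hA : 0 ≤ A) (hB : 0 ≤ B) (sa : Summable fun i => a i ^ 2)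
    (sb : Summable fun i => b i ^ 2) (la : ∑' i, a i ^ 2 ≤ A ^ 2) (lb : ∑' i, b i ^ 2 ≤ B ^ 2) :
    Summable (fun i => a i * b i) ∧ ∑' i, a i * b i ≤ A * B := by
  have h := Real.summable_and_inner_le_Lp_mul_Lq_tsum_of_nonneg
    (p := 2) (q := 2) (by constructor <;> norm_num) ha hb
    (by simpa using sa) (by simpa using sb)
  refine ⟨h.1, h.2.trans ?_⟩
  simp only [Real.rpow_two, ← Real.sqrt_eq_rpow]
  exact mul_le_mul (Real.sqrt_le_iff.2 ⟨hA, la⟩) (Real.sqrt_le_iff.2 ⟨hB, lb⟩)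
    (Real.sqrt_nonneg _) hA

variable [CompleteSpace H]

theorem exists_of_form (f : H → H → ℂ)
    (h1 : ∀ x x' y, f (x + x') y = f x y + f x' y)
    (h2 : ∀ (c : ℂ) x y, f (c • x) y = (starRingEnd ℂ c) * f x y)
    (h3 : ∀ x y y', f x (y + y') = f x y + f x y')
    (h4 : ∀ (c : ℂ) x y, f x (c • y) = c * f x y)
    (C : ℝ) (hC : ∀ x y, ‖f x y‖ ≤ C * ‖x‖ * ‖y‖) :
    ∃ T : H →L[ℂ] H, ∀ x y, ⟪x, T y⟫_ℂ = f x y := by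
  let B : H →L⋆[ℂ] H →L[ℂ] ℂ :=
    (LinearMap.mk₂'ₛₗ (starRingEnd ℂ) (RingHom.id ℂ) f h1 h2 h3 h4).mkContinuous₂ C hC
  refine ⟨ContinuousLinearMap.adjoint (InnerProductSpace.continuousLinearMapOfBilin B),
    fun x y => ?_⟩
  rw [ContinuousLinearMap.adjoint_inner_right,
    InnerProductSpace.continuousLinearMapOfBilin_apply]
  rfl

theorem wotSum_eq {ι : Type*} {A : ι → H →L[ℂ] H} {T : H →L[ℂ] H}
    (h : ∀ x y, HasSum (fun i => ⟪x, A i y⟫_ℂ) ⟪x, T y⟫_ℂ) : wotSum A = T := by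
  have : HasSum (fun i => ContinuousLinearMapWOT.ofCLM (A i)) (ContinuousLinearMapWOT.ofCLM T) := by
    refine ContinuousLinearMapWOT.tendsto_iff_forall_inner_apply_tendsto.2 fun y x => ?_
    refine (h x y).congr fun s => ?_
    have : (∑ b ∈ s, ContinuousLinearMapWOT.ofCLM (A b)) =
        ContinuousLinearMapWOT.ofCLM (∑ b ∈ s, A b) :=
      (map_sum (ContinuousLinearMapWOT.addEquiv (σ := RingHom.id ℂ) (E := H) (F := H)).symm A s).symm
    rw [this, ContinuousLinearMapWOT.ofCLM_apply, sum_apply, inner_sum]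
  rw [wotSum, this.tsum_eq]

/-- A family whose matrix elements are absolutely summable, with a uniform bound, is summable
in the weak operator topology. -/
theorem hasSum_inner_wotSum {ι : Type*} {A : ι → H →L[ℂ] H} (C : ℝ)
    (h : ∀ x y, Summable (fun i => ‖⟪x, A i y⟫_ℂ‖) ∧ ∑' i, ‖⟪x, A i y⟫_ℂ‖ ≤ C * ‖x‖ * ‖y‖)
    (x y : H) : HasSum (fun i => ⟪x, A i y⟫_ℂ) ⟪x, wotSum A y⟫_ℂ := by
  have hs : ∀ x y, Summable (fun i => ⟪x, A i y⟫_ℂ) := fun x y => (h x y).1.of_norm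
  obtain ⟨T, hT⟩ := exists_of_form (fun x y => ∑' i, ⟪x, A i y⟫_ℂ)
    (fun x x' y => by
      simp only [inner_add_left]
      exact (hs x y).tsum_add (hs x' y))
    (fun c x y => by simp only [inner_smul_left, tsum_mul_left])
    (fun x y y' => by
      simp only [map_add, inner_add_right]
      exact (hs x y).tsum_add (hs x y'))
    (fun c x y => by simp only [map_smul, inner_smul_right, tsum_mul_left])
    C (fun x y => (norm_tsum_le_tsum_norm (h x y).1).trans (h x y).2)
  have hT' : ∀ x y, HasSum (fun i => ⟪x, A i y⟫_ℂ) ⟪x, T y⟫_ℂ := fun x y => by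
    rw [hT]; exact (hs x y).hasSum
  rw [wotSum_eq hT']
  exact hT' x y

theorem hasSum_iUnion_subtype {ι : Type*} {f : ι → ℂ} (hf : Summable fun i => ‖f i‖)
    {B : ℕ → Set ι} (hB : Pairwise fun i j => Disjoint (B i) (B j)) :
    HasSum (fun k => ∑' i : B k, f i) (∑' i : ⋃ k, B k, f i) := by
  have hs : Summable (fun i : ⋃ k, B k => f i) := hf.of_norm.subtype _
  have h := ((Set.unionEqSigmaOfDisjoint hB).symm.hasSum_iff
    (f := fun i : ⋃ k, B k => f i)).2 hs.hasSum
  refine h.sigma fun k => ?_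
  have : Summable (fun i : B k => f i) := hf.of_norm.subtype _
  convert! this.hasSum using 1

/-! ### Weighted shifts -/

theorem summable_shift (e : HilbertBasis ℕ ℂ H) {ι : Type*} {c : ι → ℝ}
    (hc : ∀ n, |c n| ≤ 1) {σ τ : ι → ℕ} (hσ : σ.Injective) (hτ : τ.Injective) (x y : H) :
    Summable (fun n => ‖⟪x, ((c n : ℂ) • InnerProductSpace.rankOne ℂ (e (σ n)) (e (τ n))) y⟫_ℂ‖) ∧
    ∑' n, ‖⟪x, ((c n : ℂ) • InnerProductSpace.rankOne ℂ (e (σ n)) (e (τ n))) y⟫_ℂ‖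
      ≤ 1 * ‖x‖ * ‖y‖ := by
  have o1 : Orthonormal ℂ (fun n => e (σ n)) := e.orthonormal.comp _ hσ
  have o2 : Orthonormal ℂ (fun n => e (τ n)) := e.orthonormal.comp _ hτ
  have h := cauchySchwarz_tsum (fun n => norm_nonneg (⟪e (σ n), x⟫_ℂ))
    (fun n => norm_nonneg (⟪e (τ n), y⟫_ℂ)) (norm_nonneg x) (norm_nonneg y)
    (o1.inner_products_summable _) (o2.inner_products_summable _)
    (o1.tsum_inner_products_le _) (o2.tsum_inner_products_le _)
  have hle : ∀ n, ‖⟪x, ((c n : ℂ) • InnerProductSpace.rankOne ℂ (e (σ n)) (e (τ n))) y⟫_ℂ‖ ≤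
      ‖⟪e (σ n), x⟫_ℂ‖ * ‖⟪e (τ n), y⟫_ℂ‖ := fun n => by
    simp only [smul_apply, inner_smul_right,
      InnerProductSpace.inner_right_rankOne_apply, norm_mul, Complex.norm_real, Real.norm_eq_abs]
    rw [norm_inner_symm x]
    exact mul_le_of_le_one_left (by positivity) (hc n)
  have hs := Summable.of_nonneg_of_le (fun n => norm_nonneg _) hle h.1
  exact ⟨hs, (hs.tsum_le_tsum hle h.1).trans (h.2.trans_eq (by ring))⟩

theorem hasSum_shift (e : HilbertBasis ℕ ℂ H) {ι : Type*} {c : ι → ℝ}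
    (hc : ∀ n, |c n| ≤ 1) {σ τ : ι → ℕ} (hσ : σ.Injective) (hτ : τ.Injective) (x y : H) :
    HasSum (fun n => (c n : ℂ) * (⟪x, e (σ n)⟫_ℂ * ⟪e (τ n), y⟫_ℂ))
      ⟪x, wotSum (fun n => (c n : ℂ) • InnerProductSpace.rankOne ℂ (e (σ n)) (e (τ n))) y⟫_ℂ := by
  have h := hasSum_inner_wotSum 1 (summable_shift e hc hσ hτ) x y
  simpa only [smul_apply, inner_smul_right,
      InnerProductSpace.inner_right_rankOne_apply] using h

theorem hasSum_norm_sq_shift (e : HilbertBasis ℕ ℂ H) {ι : Type*} {c : ι → ℝ}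
    (hc : ∀ n, |c n| ≤ 1) {σ τ : ι → ℕ} (hσ : σ.Injective) (hτ : τ.Injective) (x : H) :
    HasSum (fun n => c n ^ 2 * ‖⟪e (τ n), x⟫_ℂ‖ ^ 2)
      (‖wotSum (fun n => (c n : ℂ) • InnerProductSpace.rankOne ℂ (e (σ n)) (e (τ n))) x‖ ^ 2) := by
  classical
  set T := wotSum (fun n => (c n : ℂ) • InnerProductSpace.rankOne ℂ (e (σ n)) (e (τ n))) with hT
  have hco : ∀ n, ⟪e (σ n), T x⟫_ℂ = c n * ⟪e (τ n), x⟫_ℂ := fun n => by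
    refine (hasSum_shift e hc hσ hτ (e (σ n)) x).unique ?_
    have := hasSum_single (f := fun k => (c k : ℂ) * (⟪e (σ n), e (σ k)⟫_ℂ * ⟪e (τ k), x⟫_ℂ)) n
      (fun k hk => by rw [e.orthonormal.2 (fun h => hk (hσ h).symm)]; simp)
    have h1 : ⟪e (σ n), e (σ n)⟫_ℂ = 1 := by
      rw [inner_self_eq_norm_sq_to_K, e.orthonormal.1]; simp
    simp only [h1, one_mul] at this
    exact this
  have h := hasSum_shift e hc hσ hτ (T x) x
  have h2 := Complex.hasSum_re h
  rw [← hT, inner_self_eq_norm_sq_to_K] at h2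
  convert! h2 using 1
  · funext n
    rw [← inner_conj_symm (T x), hco, map_mul, Complex.conj_ofReal, mul_assoc (c n : ℂ),
      ← Complex.normSq_eq_conj_mul_self, Complex.normSq_eq_norm_sq, ← Complex.ofReal_mul,
      ← Complex.ofReal_mul, Complex.ofReal_re]
    ring
  · norm_cast

end Weak

/-! ### Positive-operator valued measures -/

section Defs

variable {H : Type*} [NormedAddCommGroup H] [InnerProductSpace ℂ H] [CompleteSpace H]

/-- A positive-operator valued measure on `H` with outcome space `Ω`: a normalized, positive and
(in the weak operator topology) countably additive map from the measurable sets to the bounded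
operators. By convention it is `0` on non-measurable sets, which carry no information. -/
@[ext]
structure POVM (H : Type*) [NormedAddCommGroup H] [InnerProductSpace ℂ H] [CompleteSpace H]
    (Ω : Type*) [MeasurableSpace Ω] where
  toFun : Set Ω → H →L[ℂ] H
  not_measurable' : ∀ B, ¬ MeasurableSet B → toFun B = 0
  nonneg' : ∀ B, MeasurableSet B → (toFun B).IsPositive
  univ' : toFun Set.univ = 1
  iUnion' : ∀ B : ℕ → Set Ω, (∀ i, MeasurableSet (B i)) →
    Pairwise (fun i j => Disjoint (B i) (B j)) →
    ∀ x y, HasSum (fun i => ⟪x, toFun (B i) y⟫_ℂ) ⟪x, toFun (⋃ i, B i) y⟫_ℂ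

instance {Ω : Type*} [MeasurableSpace Ω] : CoeFun (POVM H Ω) (fun _ => Set Ω → H →L[ℂ] H) :=
  ⟨POVM.toFun⟩

namespace POVM

variable {Ω : Type*} [MeasurableSpace Ω]

theorem empty (E : POVM H Ω) : E ∅ = 0 := by
  refine ContinuousLinearMap.ext fun y => ext_inner_left ℂ fun x => ?_
  have h := E.iUnion' (fun _ => ∅) (fun _ => MeasurableSet.empty)
    (fun _ _ _ => Set.disjoint_empty _) x y
  have := (summable_const_iff _).1 h.summable
  simpa using this

/-- The finite measure `B ↦ ⟪x, E(B) x⟫`. -/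
def measure (E : POVM H Ω) (x : H) : Measure Ω :=
  Measure.ofMeasurable (fun B _ => ENNReal.ofReal (⟪x, E B x⟫_ℂ).re)
    (by simp [E.empty])
    (fun B hB hd => by
      have h := Complex.hasSum_re (E.iUnion' B hB hd x x)
      rw [← h.tsum_eq]
      exact ENNReal.ofReal_tsum_of_nonneg
        (fun i => (E.nonneg' _ (hB i)).re_inner_nonneg_right x) h.summable)

theorem measure_apply (E : POVM H Ω) (x : H) {B : Set Ω} (hB : MeasurableSet B) :
    E.measure x B = ENNReal.ofReal (⟪x, E B x⟫_ℂ).re :=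
  Measure.ofMeasurable_apply B hB

/-- `T = ∫ f dE` for a bounded measurable function `f : Ω → ℝ`: the weak integral, which by
polarization is determined by its diagonal matrix elements
`⟪x, T x⟫ = ∫ f(ω) ⟪x, E(dω) x⟫`. -/
def IsIntegral (E : POVM H Ω) (f : Ω → ℝ) (T : H →L[ℂ] H) : Prop :=
  ∀ x, ⟪x, T x⟫_ℂ = ((∫ ω, f ω ∂(E.measure x) : ℝ) : ℂ)

variable {Ω₁ Ω₂ : Type*} [MeasurableSpace Ω₁] [MeasurableSpace Ω₂]

/-- `E₁` is fuzzier than `E₂`: there is a Markov kernel `ν` with `E₁(B) = ∫ ν_ω(B) E₂(dω)` for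
all measurable `B`. -/
def Fuzzier (E₁ : POVM H Ω₁) (E₂ : POVM H Ω₂) : Prop :=
  ∃ ν : Kernel Ω₂ Ω₁, IsMarkovKernel ν ∧
    ∀ B, MeasurableSet B → E₂.IsIntegral (fun ω => (ν ω).real B) (E₁ B)

/-- Equivalence of POVMs: each of the two is fuzzier than the other. -/
def FuzzyEquiv (E₁ : POVM H Ω₁) (E₂ : POVM H Ω₂) : Prop :=
  E₁.Fuzzier E₂ ∧ E₂.Fuzzier E₁

end POVM

/-! ### Completely positive instruments -/

/-- Complete positivity: for each `n`, the map `Φ` applied entrywise sends positive operators on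
`Hⁿ`, written as `n × n` matrices of operators on `H`, to positive operators on `Hⁿ`. -/
def IsCompletelyPositive (Φ : (H →L[ℂ] H) →ₗ[ℂ] (H →L[ℂ] H)) : Prop :=
  ∀ (n : ℕ) (A : Fin n → Fin n → H →L[ℂ] H),
    (∀ x : Fin n → H, 0 ≤ ∑ i, ∑ j, ⟪x i, A i j (x j)⟫_ℂ) →
    ∀ x : Fin n → H, 0 ≤ ∑ i, ∑ j, ⟪x i, Φ (A i j) (x j)⟫_ℂ

/-- Normality: `Φ` preserves suprema of increasing nets of operators. -/
def IsNormalMap (Φ : (H →L[ℂ] H) →ₗ[ℂ] (H →L[ℂ] H)) : Prop :=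
  ∀ (S : Set (H →L[ℂ] H)) (a : H →L[ℂ] H), S.Nonempty → DirectedOn (· ≤ ·) S → IsLUB S a →
    IsLUB (Φ '' S) (Φ a)

/-- A completely positive instrument (in the Heisenberg picture) on `H` with outcome space `Ω`.
Countable additivity holds in the ultraweak topology, the topology induced by the functionals
`a ↦ ∑ₖ ⟪uₖ, a vₖ⟫` with `∑ₖ ‖uₖ‖² < ∞` and `∑ₖ ‖vₖ‖² < ∞`. -/
structure CPInstrument (H : Type*) [NormedAddCommGroup H] [InnerProductSpace ℂ H]
    [CompleteSpace H] (Ω : Type*) [MeasurableSpace Ω] where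
  toFun : Set Ω → (H →L[ℂ] H) →ₗ[ℂ] (H →L[ℂ] H)
  cp' : ∀ B, MeasurableSet B → IsCompletelyPositive (toFun B)
  normal' : ∀ B, MeasurableSet B → IsNormalMap (toFun B)
  univ' : toFun Set.univ 1 = 1
  iUnion' : ∀ B : ℕ → Set Ω, (∀ i, MeasurableSet (B i)) →
    Pairwise (fun i j => Disjoint (B i) (B j)) →
    ∀ (a : H →L[ℂ] H) (u v : ℕ → H), Summable (fun k => ‖u k‖ ^ 2) →
      Summable (fun k => ‖v k‖ ^ 2) →
      HasSum (fun i => ∑' k, ⟪u k, toFun (B i) a (v k)⟫_ℂ)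
        (∑' k, ⟪u k, toFun (⋃ i, B i) a (v k)⟫_ℂ)

instance {Ω : Type*} [MeasurableSpace Ω] :
    CoeFun (CPInstrument H Ω) (fun _ => Set Ω → (H →L[ℂ] H) →ₗ[ℂ] (H →L[ℂ] H)) :=
  ⟨CPInstrument.toFun⟩

namespace CPInstrument

variable {Ω : Type*} [MeasurableSpace Ω]

/-- `I_{B₁} ∘ ⋯ ∘ I_{Bₙ}` applied to the identity operator. -/
def iterate (I : CPInstrument H Ω) : (n : ℕ) → (Fin n → Set Ω) → H →L[ℂ] H
  | 0, _ => 1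
  | n + 1, B => I (B 0) (iterate I n (fun i => B i.succ))

/-- `E` is the infinite composition of the instrument `I`: the POVM on `Ω^∞` such that
`E(B₁ × ⋯ × Bₙ × Ω^∞) = (I_{B₁} ∘ ⋯ ∘ I_{Bₙ})(1)` for all `n ≥ 1` and all measurable `Bᵢ`. -/
def IsInfiniteComposition (I : CPInstrument H Ω) (E : POVM H (ℕ → Ω)) : Prop :=
  ∀ (n : ℕ), 1 ≤ n → ∀ B : Fin n → Set Ω, (∀ i, MeasurableSet (B i)) →
    E {ω | ∀ i : Fin n, ω i ∈ B i} = I.iterate n B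

end CPInstrument
/-! ### Instruments given by a family of operators -/

theorem isPositive_iff_inner {T : H →L[ℂ] H} : T.IsPositive ↔ ∀ x, 0 ≤ ⟪x, T x⟫_ℂ := by
  refine ⟨fun h x => h.inner_nonneg_right x, fun h => ?_⟩
  rw [ContinuousLinearMap.isPositive_iff_complex]
  intro x
  have h1 := Complex.nonneg_iff.1 (h x)
  have h2 : ⟪T x, x⟫_ℂ = ⟪x, T x⟫_ℂ := by
    rw [← inner_conj_symm, Complex.conj_eq_iff_im]
    exact h1.2.symm
  rw [h2]
  exact ⟨Complex.ext (by simp) (by simpa using h1.2), h1.1⟩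

theorem le_iff_inner {S T : H →L[ℂ] H} : S ≤ T ↔ ∀ x, 0 ≤ ⟪x, T x⟫_ℂ - ⟪x, S x⟫_ℂ := by
  rw [ContinuousLinearMap.le_def, isPositive_iff_inner]
  simp only [sub_apply, inner_sub_right]

open Filter Topology in
/-- An increasing net of operators converges weakly to its supremum, and is eventually bounded. -/
theorem tendsto_of_isLUB {S : Set (H →L[ℂ] H)} {a : H →L[ℂ] H} (hne : S.Nonempty)
    (hd : DirectedOn (· ≤ ·) S) (ha : IsLUB S a) :
    (∃ C, ∀ᶠ s : S in atTop, ‖(s : H →L[ℂ] H)‖ ≤ C) ∧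
    ∀ x y, Tendsto (fun s : S => ⟪x, (s : H →L[ℂ] H) y⟫_ℂ) atTop (𝓝 ⟪x, a y⟫_ℂ) := by
  have : Nonempty S := hne.to_subtype
  have : IsDirectedOrder S := directedOn_iff_isDirectedOrder.1 hd
  obtain ⟨s₀⟩ := ‹Nonempty S›
  have hpos : ∀ s : S, ∀ x, 0 ≤ ⟪x, a x⟫_ℂ - ⟪x, (s : H →L[ℂ] H) x⟫_ℂ :=
    fun s => le_iff_inner.1 (ha.1 s.2)
  have hbd : ∀ᶠ s : S in atTop, ‖a - (s : H →L[ℂ] H)‖ ≤ ‖a - (s₀ : H →L[ℂ] H)‖ := by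
    filter_upwards [eventually_ge_atTop s₀] with s hs
    exact CStarAlgebra.norm_le_norm_of_nonneg_of_le (sub_nonneg.2 (ha.1 s.2))
      (sub_le_sub_left (show (s₀ : H →L[ℂ] H) ≤ s from hs) a)
  have hdiag : ∀ x, ∃ l : ℂ,
      Tendsto (fun s : S => ⟪x, (a - (s : H →L[ℂ] H)) x⟫_ℂ) atTop (𝓝 l) := fun x => by
    have hanti : Antitone (fun s : S => (⟪x, (a - (s : H →L[ℂ] H)) x⟫_ℂ).re) := fun s t hst => by
      have := (Complex.nonneg_iff.1 (le_iff_inner.1 (show (s : H →L[ℂ] H) ≤ t from hst) x)).1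
      simp only [sub_apply, inner_sub_right, Complex.sub_re] at this ⊢
      linarith
    have hb : BddBelow (Set.range (fun s : S => (⟪x, (a - (s : H →L[ℂ] H)) x⟫_ℂ).re)) := by
      refine ⟨0, ?_⟩
      rintro _ ⟨s, rfl⟩
      have := (Complex.nonneg_iff.1 (hpos s x)).1
      simpa only [sub_apply, inner_sub_right] using this
    refine ⟨_, ((Complex.continuous_ofReal.tendsto _).comp
      (tendsto_atTop_ciInf hanti hb)).congr fun s => ?_⟩
    have := (Complex.nonneg_iff.1 (hpos s x)).2
    refine Complex.ext (by simp) ?_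
    simpa only [Function.comp_apply, Complex.ofReal_im, sub_apply, inner_sub_right] using this
  have hoff : ∀ x y, ∃ l : ℂ,
      Tendsto (fun s : S => ⟪x, (a - (s : H →L[ℂ] H)) y⟫_ℂ) atTop (𝓝 l) := fun x y => by
    obtain ⟨l1, h1⟩ := hdiag (x + y)
    obtain ⟨l2, h2⟩ := hdiag (x - y)
    obtain ⟨l3, h3⟩ := hdiag (x + Complex.I • y)
    obtain ⟨l4, h4⟩ := hdiag (x - Complex.I • y)
    refine ⟨(l1 - l2 - Complex.I * l3 + Complex.I * l4) / 4,
      ((((h1.sub h2).sub (h3.const_mul Complex.I)).add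
        (h4.const_mul Complex.I)).div_const 4).congr fun s => ?_⟩
    simp only [map_add, map_sub, inner_add_left, inner_add_right, map_smul, inner_smul_left,
      inner_smul_right, Complex.conj_I, inner_sub_left, inner_sub_right]
    linear_combination (-(1 : ℂ) / 2 * ⟪x, (a - (s : H →L[ℂ] H)) y⟫_ℂ +
      1 / 2 * ⟪y, (a - (s : H →L[ℂ] H)) x⟫_ℂ) * Complex.I_sq
  choose f hf using hoff
  obtain ⟨T, hT⟩ := exists_of_form f
    (fun x x' y => tendsto_nhds_unique (hf (x + x') y)
      (((hf x y).add (hf x' y)).congr fun s => (inner_add_left _ _ _).symm))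
    (fun c x y => tendsto_nhds_unique (hf (c • x) y)
      (((hf x y).const_mul _).congr fun s => (inner_smul_left _ _ _).symm))
    (fun x y y' => tendsto_nhds_unique (hf x (y + y'))
      (((hf x y).add (hf x y')).congr fun s => by rw [map_add, inner_add_right]))
    (fun c x y => tendsto_nhds_unique (hf x (c • y))
      (((hf x y).const_mul _).congr fun s => by rw [map_smul, inner_smul_right]))
    ‖a - (s₀ : H →L[ℂ] H)‖
    (fun x y => le_of_tendsto (hf x y).norm (by
      filter_upwards [hbd] with s hs
      calc ‖⟪x, (a - (s : H →L[ℂ] H)) y⟫_ℂ‖ ≤ ‖x‖ * ‖(a - (s : H →L[ℂ] H)) y‖ :=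
            norm_inner_le_norm _ _
        _ ≤ ‖x‖ * (‖a - (s₀ : H →L[ℂ] H)‖ * ‖y‖) := by
            gcongr
            exact (ContinuousLinearMap.le_opNorm _ _).trans (by gcongr)
        _ = _ := by ring))
  simp only [← hT] at hf
  have hT0 : (0 : H →L[ℂ] H) ≤ T := le_iff_inner.2 fun x => by
    simp only [zero_apply, inner_zero_right, sub_zero]
    refine ge_of_tendsto' (hf x x) fun s => ?_
    simpa only [sub_apply, inner_sub_right] using hpos s x
  have hub : a - T ∈ upperBounds S := fun s hs => le_iff_inner.2 fun x => by
    have h1 : ∀ᶠ t : S in atTop, 0 ≤ ⟪x, (a - s) x⟫_ℂ - ⟪x, (a - (t : H →L[ℂ] H)) x⟫_ℂ := by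
      filter_upwards [eventually_ge_atTop ⟨s, hs⟩] with t ht
      have := le_iff_inner.1 (show s ≤ (t : H →L[ℂ] H) from ht) x
      simp only [sub_apply, inner_sub_right]
      convert this using 1
      ring
    have h2 := ge_of_tendsto ((hf x x).const_sub ⟪x, (a - s) x⟫_ℂ) h1
    simp only [sub_apply, inner_sub_right] at h2 ⊢
    convert h2 using 1
    ring
  have hTz : T = 0 := le_antisymm (by simpa using ha.2 hub) hT0
  subst hTz
  refine ⟨⟨‖a‖ + ‖a - (s₀ : H →L[ℂ] H)‖, ?_⟩, fun x y => ?_⟩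
  · filter_upwards [hbd] with s hs
    calc ‖(s : H →L[ℂ] H)‖ = ‖a - (a - s)‖ := by rw [sub_sub_cancel]
      _ ≤ _ := (norm_sub_le _ _).trans (by gcongr)
  · have := (hf x y).const_sub ⟪x, a y⟫_ℂ
    simpa only [sub_apply, inner_sub_right, sub_sub_cancel, zero_apply, inner_zero_right,
      sub_zero] using this

/-- The matrix elements of `K* b K`, summed over the family. -/
theorem summable_kraus {K : ℕ → H →L[ℂ] H} (hK : ∀ x, HasSum (fun m => ‖K m x‖ ^ 2) (‖x‖ ^ 2))
    (b : H →L[ℂ] H) (x y : H) :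
    Summable (fun m => ‖⟪K m x, b (K m y)⟫_ℂ‖) ∧
      ∑' m, ‖⟪K m x, b (K m y)⟫_ℂ‖ ≤ ‖b‖ * ‖x‖ * ‖y‖ := by
  have h := cauchySchwarz_tsum (fun m => norm_nonneg (K m x)) (fun m => norm_nonneg (K m y))
    (norm_nonneg x) (norm_nonneg y) (hK x).summable (hK y).summable (hK x).tsum_eq.le
    (hK y).tsum_eq.le
  have hle : ∀ m, ‖⟪K m x, b (K m y)⟫_ℂ‖ ≤ ‖b‖ * (‖K m x‖ * ‖K m y‖) := fun m =>
    calc ‖⟪K m x, b (K m y)⟫_ℂ‖ ≤ ‖K m x‖ * ‖b (K m y)‖ := norm_inner_le_norm _ _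
      _ ≤ ‖K m x‖ * (‖b‖ * ‖K m y‖) := by gcongr; exact b.le_opNorm _
      _ = _ := by ring
  have hs := Summable.of_nonneg_of_le (fun m => norm_nonneg _) hle (h.1.mul_left _)
  refine ⟨hs, (hs.tsum_le_tsum hle (h.1.mul_left _)).trans ?_⟩
  rw [tsum_mul_left, mul_assoc]
  exact mul_le_mul_of_nonneg_left h.2 (norm_nonneg _)

theorem hasSum_kraus {K : ℕ → H →L[ℂ] H} (hK : ∀ x, HasSum (fun m => ‖K m x‖ ^ 2) (‖x‖ ^ 2))
    (B : Set ℕ) (b : H →L[ℂ] H) (x y : H) :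
    HasSum (fun m : B => ⟪K m x, b (K m y)⟫_ℂ)
      ⟪x, wotSum (fun m : B => ContinuousLinearMap.adjoint (K m) ∘L b ∘L K m) y⟫_ℂ := by
  have := hasSum_inner_wotSum (A := fun m : B => ContinuousLinearMap.adjoint (K m) ∘L b ∘L K m)
    ‖b‖ (fun x y => by
      simp only [ContinuousLinearMap.comp_apply, ContinuousLinearMap.adjoint_inner_right]
      have h := summable_kraus hK b x y
      refine ⟨h.1.subtype _, le_trans ?_ h.2⟩
      exact h.1.tsum_subtype_le _ B (fun m => norm_nonneg _)) x y
  simpa only [ContinuousLinearMap.comp_apply, ContinuousLinearMap.adjoint_inner_right] using this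

/-- The map `b ↦ ∑_{m ∈ B} Kₘ* b Kₘ`, the sum being taken in the weak operator topology. -/
def krausMap (K : ℕ → H →L[ℂ] H) (hK : ∀ x, HasSum (fun m => ‖K m x‖ ^ 2) (‖x‖ ^ 2))
    (B : Set ℕ) : (H →L[ℂ] H) →ₗ[ℂ] (H →L[ℂ] H) where
  toFun b := wotSum (fun m : B => ContinuousLinearMap.adjoint (K m) ∘L b ∘L K m)
  map_add' b b' := ContinuousLinearMap.ext fun y => ext_inner_left ℂ fun x => by
    rw [add_apply, inner_add_right, ← (hasSum_kraus hK B b x y).tsum_eq,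
      ← (hasSum_kraus hK B b' x y).tsum_eq, ← (hasSum_kraus hK B (b + b') x y).tsum_eq,
      ← (hasSum_kraus hK B b x y).summable.tsum_add (hasSum_kraus hK B b' x y).summable]
    simp only [add_apply, inner_add_right]
  map_smul' c b := ContinuousLinearMap.ext fun y => ext_inner_left ℂ fun x => by
    rw [RingHom.id_apply, smul_apply, inner_smul_right, ← (hasSum_kraus hK B b x y).tsum_eq,
      ← (hasSum_kraus hK B (c • b) x y).tsum_eq, ← tsum_mul_left]
    simp only [smul_apply, inner_smul_right]

theorem inner_krausMap {K : ℕ → H →L[ℂ] H} (hK : ∀ x, HasSum (fun m => ‖K m x‖ ^ 2) (‖x‖ ^ 2))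
    (B : Set ℕ) (b : H →L[ℂ] H) (x y : H) :
    ⟪x, krausMap K hK B b y⟫_ℂ = ∑' m : B, ⟪K m x, b (K m y)⟫_ℂ :=
  (hasSum_kraus hK B b x y).tsum_eq.symm

theorem summable_kraus_prod {K : ℕ → H →L[ℂ] H}
    (hK : ∀ x, HasSum (fun m => ‖K m x‖ ^ 2) (‖x‖ ^ 2)) (a : H →L[ℂ] H) {u v : ℕ → H}
    (hu : Summable fun k => ‖u k‖ ^ 2) (hv : Summable fun k => ‖v k‖ ^ 2) :
    Summable (fun p : ℕ × ℕ => ‖⟪K p.2 (u p.1), a (K p.2 (v p.1))⟫_ℂ‖) := by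
  have hp : ∀ {w : ℕ → H}, (Summable fun k => ‖w k‖ ^ 2) →
      Summable (fun p : ℕ × ℕ => ‖K p.2 (w p.1)‖ ^ 2) := fun {w} hw => by
    have h := summable_prod_of_nonneg (f := fun p : ℕ × ℕ => ‖K p.2 (w p.1)‖ ^ 2)
      (fun p => sq_nonneg _)
    refine h.2 ⟨fun k => (hK (w k)).summable, ?_⟩
    have h3 : (fun k => ∑' m, ‖K m (w k)‖ ^ 2) = fun k => ‖w k‖ ^ 2 :=
      funext fun k => (hK (w k)).tsum_eq
    show Summable (fun k => ∑' m, ‖K m (w k)‖ ^ 2)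
    rw [h3]
    exact hw
  refine Summable.of_nonneg_of_le (fun p => norm_nonneg _) (fun p => ?_)
    (((hp hu).add (hp hv)).mul_left ‖a‖)
  calc ‖⟪K p.2 (u p.1), a (K p.2 (v p.1))⟫_ℂ‖ ≤ ‖K p.2 (u p.1)‖ * ‖a (K p.2 (v p.1))‖ :=
        norm_inner_le_norm _ _
    _ ≤ ‖K p.2 (u p.1)‖ * (‖a‖ * ‖K p.2 (v p.1)‖) := by gcongr; exact a.le_opNorm _
    _ = ‖a‖ * (‖K p.2 (u p.1)‖ * ‖K p.2 (v p.1)‖) := by ring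
    _ ≤ _ := by
      gcongr
      nlinarith [sq_nonneg (‖K p.2 (u p.1)‖ - ‖K p.2 (v p.1)‖), sq_nonneg (‖K p.2 (u p.1)‖),
        sq_nonneg (‖K p.2 (v p.1)‖)]

theorem krausMap_cp {K : ℕ → H →L[ℂ] H} (hK : ∀ x, HasSum (fun m => ‖K m x‖ ^ 2) (‖x‖ ^ 2))
    (B : Set ℕ) : IsCompletelyPositive (krausMap K hK B) := fun n A hA x => by
  have h : HasSum (fun m : B => ∑ i, ∑ j, ⟪K m (x i), A i j (K m (x j))⟫_ℂ)
      (∑ i, ∑ j, ⟪x i, krausMap K hK B (A i j) (x j)⟫_ℂ) :=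
    hasSum_sum fun i _ => hasSum_sum fun j _ => hasSum_kraus hK B (A i j) (x i) (x j)
  exact HasSum.nonneg (fun m : B => hA fun i => K m (x i)) h

open Filter Topology in
theorem krausMap_normal {K : ℕ → H →L[ℂ] H}
    (hK : ∀ x, HasSum (fun m => ‖K m x‖ ^ 2) (‖x‖ ^ 2)) (B : Set ℕ) :
    IsNormalMap (krausMap K hK B) := by
  intro S a hne hd ha
  have hmono : ∀ {b c : H →L[ℂ] H}, b ≤ c → krausMap K hK B b ≤ krausMap K hK B c := by
    intro b c hbc
    refine le_iff_inner.2 fun x => ?_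
    exact HasSum.nonneg (fun m : B => le_iff_inner.1 hbc (K m x))
      ((hasSum_kraus hK B c x x).sub (hasSum_kraus hK B b x x))
  refine ⟨?_, fun b hb => le_iff_inner.2 fun x => ?_⟩
  · rintro _ ⟨s, hs, rfl⟩
    exact hmono (ha.1 hs)
  · have : Nonempty S := hne.to_subtype
    have : IsDirectedOrder S := directedOn_iff_isDirectedOrder.1 hd
    obtain ⟨⟨C, hC⟩, hlim⟩ := tendsto_of_isLUB hne hd ha
    have ht : Tendsto (fun s : S => ∑' m : B, ⟪K m x, (s : H →L[ℂ] H) (K m x)⟫_ℂ) atTop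
        (𝓝 (∑' m : B, ⟪K m x, a (K m x)⟫_ℂ)) := by
      refine tendsto_tsum_of_dominated_convergence
        (bound := fun m : B => C * ‖K m x‖ ^ 2) (((hK x).summable.subtype B).mul_left C)
        (fun m => hlim _ _) ?_
      filter_upwards [hC] with s hs m
      calc ‖⟪K m x, (s : H →L[ℂ] H) (K m x)⟫_ℂ‖ ≤ ‖K m x‖ * ‖(s : H →L[ℂ] H) (K m x)‖ :=
            norm_inner_le_norm _ _
        _ ≤ ‖K m x‖ * (C * ‖K m x‖) := by
            gcongr
            exact (ContinuousLinearMap.le_opNorm _ _).trans (by gcongr)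
        _ = _ := by ring
    rw [inner_krausMap]
    refine ge_of_tendsto' (ht.const_sub _) fun s => ?_
    have := le_iff_inner.1 (hb ⟨s, s.2, rfl⟩) x
    rwa [inner_krausMap] at this

/-- The instrument `B ↦ (b ↦ ∑_{m ∈ B} Kₘ* b Kₘ)` of a family `K` with `∑ₘ Kₘ* Kₘ = 1`. -/
def krausInstrument (K : ℕ → H →L[ℂ] H) (hK : ∀ x, HasSum (fun m => ‖K m x‖ ^ 2) (‖x‖ ^ 2)) :
    CPInstrument H ℕ where
  toFun := krausMap K hK
  cp' B _ := krausMap_cp hK B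
  normal' B _ := krausMap_normal hK B
  univ' := by
    have h : ∀ x, ⟪x, krausMap K hK Set.univ 1 x⟫_ℂ = ⟪x, (1 : H →L[ℂ] H) x⟫_ℂ := fun x => by
      rw [inner_krausMap, tsum_univ (fun m => ⟪K m x, (1 : H →L[ℂ] H) (K m x)⟫_ℂ)]
      have h1 := Complex.hasSum_ofReal.2 (hK x)
      have h2 : ∀ z : H, ⟪z, (1 : H →L[ℂ] H) z⟫_ℂ = ((‖z‖ ^ 2 : ℝ) : ℂ) := fun z => by
        rw [show (1 : H →L[ℂ] H) z = z from rfl, inner_self_eq_norm_sq_to_K]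
        norm_cast
      simp only [h2]
      exact h1.tsum_eq
    exact le_antisymm (le_iff_inner.2 fun x => by rw [h, sub_self])
      (le_iff_inner.2 fun x => by rw [h, sub_self])
  iUnion' B _ hd a u v hu hv := by
    have hs := summable_kraus_prod hK a hu hv
    have hs' := hs.prod_symm
    have key : ∀ A : Set ℕ, ∑' k, ⟪u k, krausMap K hK A a (v k)⟫_ℂ =
        ∑' m : A, ∑' k, ⟪K m (u k), a (K m (v k))⟫_ℂ := fun A => by
      simp only [inner_krausMap]
      have hinj : Function.Injective (fun p : ℕ × A => (p.1, (p.2 : ℕ))) := by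
        rintro ⟨a, b⟩ ⟨c, d⟩ h
        simp only [Prod.mk.injEq, Subtype.coe_inj] at h
        exact Prod.ext h.1 h.2
      have h1 : Summable (Function.uncurry fun (k : ℕ) (m : A) =>
          ⟪K m (u k), a (K m (v k))⟫_ℂ) := (hs.comp_injective hinj).of_norm
      exact h1.tsum_comm.symm
    rw [key]
    simp only [key]
    refine hasSum_iUnion_subtype (f := fun m => ∑' k, ⟪K m (u k), a (K m (v k))⟫_ℂ) ?_ hd
    have h2 := hs'.prod
    refine Summable.of_nonneg_of_le (fun m => norm_nonneg _) (fun m => ?_) h2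
    exact norm_tsum_le_tsum_norm (hs'.prod_factor m)

/-! ### The photon counting and quantum counter instruments -/

theorem hasSum_sigma_of_nonneg {α : Type*} {β : α → Type*} {f : (Σ a, β a) → ℝ}
    (h0 : ∀ s, 0 ≤ f s) {g : α → ℝ} (hf : ∀ a, HasSum (fun b => f ⟨a, b⟩) (g a)) {S : ℝ}
    (hg : HasSum g S) : HasSum f S := by
  have hs : Summable f := (summable_sigma_of_nonneg h0).2
    ⟨fun a => (hf a).summable, by simpa only [(hf _).tsum_eq] using hg.summable⟩
  exact (hs.hasSum.sigma hf).unique hg ▸ hs.hasSum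

theorem hasSum_norm_sq_repr (e : HilbertBasis ℕ ℂ H) (x : H) :
    HasSum (fun k => ‖⟪e k, x⟫_ℂ‖ ^ 2) (‖x‖ ^ 2) := by
  have h := Complex.hasSum_re (e.hasSum_inner_mul_inner x x)
  rw [inner_self_eq_norm_sq_to_K] at h
  convert! h using 1
  · funext k
    rw [← inner_conj_symm x, ← Complex.normSq_eq_conj_mul_self, Complex.ofReal_re,
      Complex.normSq_eq_norm_sq]
  · norm_cast

/-- The probability `p(m | n) = C(n, m) (1 - e^{-λt})^m e^{-λt(n-m)}` of counting `m` of `n` photons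
in the photon counting measurement. It vanishes for `m > n`. -/
def pcProb (lam t : ℝ) (m n : ℕ) : ℝ :=
  (n.choose m : ℝ) * (1 - Real.exp (-(lam * t))) ^ m * Real.exp (-(lam * t) * ((n : ℝ) - m))

/-- `M_m = ∑ₙ √p(m | m + n) |n⟩⟨n + m|`. -/
def pcOp (e : HilbertBasis ℕ ℂ H) (lam t : ℝ) (m : ℕ) : H →L[ℂ] H :=
  wotSum fun n : ℕ =>
    ((√(pcProb lam t m (m + n)) : ℝ) : ℂ) • InnerProductSpace.rankOne ℂ (e n) (e (n + m))

/-- The probability `p(m | n) = C(n + m, m) (e^{λt} - 1)^m e^{-λt(n+m+1)}` of the count `m` for `n`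
photons in the quantum counter measurement. -/
def qcProb (lam t : ℝ) (m n : ℕ) : ℝ :=
  ((n + m).choose m : ℝ) * (Real.exp (lam * t) - 1) ^ m *
    Real.exp (-(lam * t) * ((n : ℝ) + m + 1))

/-- `M_m = ∑ₙ √p(m | n) |n + m⟩⟨n|`. -/
def qcOp (e : HilbertBasis ℕ ℂ H) (lam t : ℝ) (m : ℕ) : H →L[ℂ] H :=
  wotSum fun n : ℕ =>
    ((√(qcProb lam t m n) : ℝ) : ℂ) • InnerProductSpace.rankOne ℂ (e (n + m)) (e n)

theorem pcProb_nonneg {lam t : ℝ} (h : 0 < lam * t) (m n : ℕ) : 0 ≤ pcProb lam t m n := by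
  have : 0 ≤ 1 - Real.exp (-(lam * t)) := by
    rw [sub_nonneg, Real.exp_le_one_iff]; linarith
  unfold pcProb
  positivity

theorem sum_pcProb (lam t : ℝ) (n : ℕ) :
    ∑ p ∈ Finset.HasAntidiagonal.antidiagonal n, pcProb lam t p.1 n = 1 := by
  have h := (Commute.all (1 - Real.exp (-(lam * t))) (Real.exp (-(lam * t)))).add_pow' n
  rw [sub_add_cancel, one_pow] at h
  rw [h]
  refine Finset.sum_congr rfl fun p hp => ?_
  rw [Finset.HasAntidiagonal.mem_antidiagonal] at hp
  rw [pcProb, nsmul_eq_mul, mul_assoc, ← Real.exp_nat_mul, ← hp]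
  push_cast
  ring_nf

theorem pcProb_le_one {lam t : ℝ} (h : 0 < lam * t) (m n : ℕ) : pcProb lam t m (m + n) ≤ 1 := by
  rw [← sum_pcProb lam t (m + n)]
  exact Finset.single_le_sum (f := fun p : ℕ × ℕ => pcProb lam t p.1 (m + n))
    (fun p _ => pcProb_nonneg h _ _) (Finset.HasAntidiagonal.mem_antidiagonal.2 (rfl : (m, n).1 + (m, n).2 = m + n))

theorem hasSum_pcOp (e : HilbertBasis ℕ ℂ H) {lam t : ℝ} (hlam : 0 < lam) (ht : 0 < t) (x : H) :
    HasSum (fun m => ‖pcOp e lam t m x‖ ^ 2) (‖x‖ ^ 2) := by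
  have hp := mul_pos hlam ht
  have h1 : ∀ m, HasSum (fun n => pcProb lam t m (m + n) * ‖⟪e (n + m), x⟫_ℂ‖ ^ 2)
      (‖pcOp e lam t m x‖ ^ 2) := fun m => by
    have := hasSum_norm_sq_shift e (c := fun n => √(pcProb lam t m (m + n)))
      (fun n => by
        rw [abs_of_nonneg (Real.sqrt_nonneg _)]
        exact Real.sqrt_le_one.2 (pcProb_le_one hp m n))
      (σ := fun n => n) (τ := fun n => n + m) (fun _ _ h => h) (add_left_injective m) x
    simp only [Real.sq_sqrt (pcProb_nonneg hp _ _)] at this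
    exact this
  have h2 : HasSum (fun p : ℕ × ℕ => pcProb lam t p.1 (p.1 + p.2) * ‖⟪e (p.2 + p.1), x⟫_ℂ‖ ^ 2)
      (‖x‖ ^ 2) := by
    rw [← Finset.HasAntidiagonal.sigmaAntidiagonalEquivProd.hasSum_iff]
    refine hasSum_sigma_of_nonneg (fun s => mul_nonneg (pcProb_nonneg hp _ _) (by positivity))
      (fun k => ?_) (hasSum_norm_sq_repr e x)
    have h3 : ∑ p : Finset.HasAntidiagonal.antidiagonal k, pcProb lam t p.1.1 k * ‖⟪e k, x⟫_ℂ‖ ^ 2 =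
        ‖⟪e k, x⟫_ℂ‖ ^ 2 := by
      rw [Finset.sum_coe_sort (Finset.HasAntidiagonal.antidiagonal k)
        (fun p => pcProb lam t p.1 k * ‖⟪e k, x⟫_ℂ‖ ^ 2), ← Finset.sum_mul, sum_pcProb, one_mul]
    have h4 := hasSum_fintype
      (fun p : Finset.HasAntidiagonal.antidiagonal k => pcProb lam t p.1.1 k * ‖⟪e k, x⟫_ℂ‖ ^ 2)
    rw [h3] at h4
    convert! h4 using 1
    funext p
    have := Finset.HasAntidiagonal.mem_antidiagonal.1 p.2
    simp only [Finset.HasAntidiagonal.sigmaAntidiagonalEquivProd_apply]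
    rw [add_comm p.1.2, this]
  exact h2.prod_fiberwise h1

theorem qcProb_nonneg {lam t : ℝ} (h : 0 < lam * t) (m n : ℕ) : 0 ≤ qcProb lam t m n := by
  have : 0 ≤ Real.exp (lam * t) - 1 := by
    rw [sub_nonneg, Real.one_le_exp_iff]; exact h.le
  unfold qcProb
  positivity

theorem hasSum_qcProb {lam t : ℝ} (h : 0 < lam * t) (n : ℕ) :
    HasSum (fun m => qcProb lam t m n) 1 := by
  set q := 1 - Real.exp (-(lam * t)) with hq
  have hq1 : ‖q‖ < 1 := by
    rw [Real.norm_eq_abs, abs_lt]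
    have h1 : Real.exp (-(lam * t)) < 1 := by rw [Real.exp_lt_one_iff]; linarith
    have h2 := Real.exp_pos (-(lam * t))
    constructor <;> linarith
  have hs := (hasSum_choose_mul_geometric_of_norm_lt_one n hq1).mul_right
    (Real.exp (-(lam * t)) ^ (n + 1))
  rw [show 1 - q = Real.exp (-(lam * t)) by rw [hq]; ring,
    one_div_mul_cancel (pow_ne_zero _ (Real.exp_pos _).ne')] at hs
  convert! hs using 1
  funext m
  have h3 : q = (Real.exp (lam * t) - 1) * Real.exp (-(lam * t)) := by
    rw [sub_mul, ← Real.exp_add, add_neg_cancel, Real.exp_zero, one_mul]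
  have h4 : Real.exp (-(lam * t) * ((n : ℝ) + m + 1)) =
      Real.exp (-(lam * t)) ^ m * Real.exp (-(lam * t)) ^ (n + 1) := by
    rw [← pow_add, ← Real.exp_nat_mul]
    push_cast
    ring_nf
  rw [qcProb, h3, h4, mul_pow, add_comm n m, Nat.choose_symm_add]
  ring

theorem hasSum_qcOp (e : HilbertBasis ℕ ℂ H) {lam t : ℝ} (hlam : 0 < lam) (ht : 0 < t) (x : H) :
    HasSum (fun m => ‖qcOp e lam t m x‖ ^ 2) (‖x‖ ^ 2) := by
  have hp := mul_pos hlam ht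
  have h1 : ∀ m, HasSum (fun n => qcProb lam t m n * ‖⟪e n, x⟫_ℂ‖ ^ 2)
      (‖qcOp e lam t m x‖ ^ 2) := fun m => by
    have := hasSum_norm_sq_shift e (c := fun n => √(qcProb lam t m n))
      (fun n => by
        rw [abs_of_nonneg (Real.sqrt_nonneg _)]
        exact Real.sqrt_le_one.2
          (le_hasSum (hasSum_qcProb hp n) m fun k _ => qcProb_nonneg hp k n))
      (σ := fun n => n + m) (τ := fun n => n) (add_left_injective m) (fun _ _ h => h) x
    simp only [Real.sq_sqrt (qcProb_nonneg hp _ _)] at this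
    exact this
  have h2 : HasSum (fun p : ℕ × ℕ => qcProb lam t p.2 p.1 * ‖⟪e p.1, x⟫_ℂ‖ ^ 2) (‖x‖ ^ 2) := by
    rw [← (Equiv.sigmaEquivProd ℕ ℕ).hasSum_iff]
    refine hasSum_sigma_of_nonneg (fun s => mul_nonneg (qcProb_nonneg hp _ _) (by positivity))
      (fun k => ?_) (hasSum_norm_sq_repr e x)
    have := (hasSum_qcProb hp k).mul_right (‖⟪e k, x⟫_ℂ‖ ^ 2)
    rw [one_mul] at this
    exact this
  have h3 := (Equiv.prodComm ℕ ℕ).hasSum_iff.2 h2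
  exact h3.prod_fiberwise h1

/-- The photon counting instrument `I_B(b) = ∑_{m ∈ B} M_m* b M_m`. -/
def pcInstrument (e : HilbertBasis ℕ ℂ H) {lam t : ℝ} (hlam : 0 < lam) (ht : 0 < t) :
    CPInstrument H ℕ :=
  krausInstrument (pcOp e lam t) (hasSum_pcOp e hlam ht)

/-- The quantum counter instrument `I_B(b) = ∑_{m ∈ B} M_m* b M_m`. -/
def qcInstrument (e : HilbertBasis ℕ ℂ H) {lam t : ℝ} (hlam : 0 < lam) (ht : 0 < t) :
    CPInstrument H ℕ :=
  krausInstrument (qcOp e lam t) (hasSum_qcOp e hlam ht)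

/-! ### The photon number observable -/

theorem hasSum_number (e : HilbertBasis ℕ ℂ H) (B : Set ℕ) (x y : H) :
    HasSum (fun n : B => ⟪x, e n⟫_ℂ * ⟪e n, y⟫_ℂ)
      ⟪x, wotSum (fun n : B => InnerProductSpace.rankOne ℂ (e n) (e n)) y⟫_ℂ := by
  have := hasSum_shift e (c := fun _ : B => (1 : ℝ)) (fun _ => by simp)
    (σ := fun n : B => (n : ℕ)) (τ := fun n : B => (n : ℕ)) Subtype.coe_injective
    Subtype.coe_injective x y
  simpa only [Complex.ofReal_one, one_mul, one_smul] using this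

/-- The photon number observable `E^N(B) = ∑_{n ∈ B} |n⟩⟨n|`. -/
def numberPOVM (e : HilbertBasis ℕ ℂ H) : POVM H ℕ where
  toFun B := wotSum fun n : B => InnerProductSpace.rankOne ℂ (e n) (e n)
  not_measurable' B hB := absurd (MeasurableSet.of_discrete) hB
  nonneg' B _ := isPositive_iff_inner.2 fun x => by
    refine HasSum.nonneg (fun n : B => ?_) (hasSum_number e B x x)
    rw [← inner_conj_symm x, ← Complex.normSq_eq_conj_mul_self]
    exact Complex.zero_le_real.2 (Complex.normSq_nonneg _)
  univ' := ContinuousLinearMap.ext fun y => ext_inner_left ℂ fun x => by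
    rw [← (hasSum_number e Set.univ x y).tsum_eq, tsum_univ (fun n => ⟪x, e n⟫_ℂ * ⟪e n, y⟫_ℂ)]
    exact e.tsum_inner_mul_inner x y
  iUnion' B _ hd x y := by
    simp only [← (hasSum_number e _ x y).tsum_eq]
    exact hasSum_iUnion_subtype (e.summable_inner_mul_inner x y).norm hd

/-! ### The continuous observable -/

/-- Lebesgue measure on the half-line `(0, ∞)`. -/
def volPos : Measure (Set.Ioi (0 : ℝ)) := Measure.comap (fun x : Set.Ioi (0 : ℝ) => (x : ℝ)) volume

/-- The Poisson weight `e^{-x} x^n / n!`. -/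
def poissonWeight (n : ℕ) (x : ℝ) : ℝ := Real.exp (-x) * x ^ n / (n.factorial : ℝ)

/-- `F_x = ∑ₙ e^{-x} x^n / n! |n⟩⟨n|`. -/
def poissonOp (e : HilbertBasis ℕ ℂ H) (x : ℝ) : H →L[ℂ] H :=
  wotSum fun n : ℕ => ((poissonWeight n x : ℝ) : ℂ) • InnerProductSpace.rankOne ℂ (e n) (e n)

theorem poissonWeight_nonneg (n : ℕ) (x : Set.Ioi (0 : ℝ)) : 0 ≤ poissonWeight n x := by
  have : (0 : ℝ) < x := x.2
  unfold poissonWeight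
  positivity

theorem poissonWeight_le_one (n : ℕ) (x : Set.Ioi (0 : ℝ)) : poissonWeight n x ≤ 1 := by
  have h : (0 : ℝ) < x := x.2
  have := Real.pow_div_factorial_le_exp (x : ℝ) h.le n
  rw [poissonWeight, mul_div_assoc]
  calc Real.exp (-x) * ((x : ℝ) ^ n / (n.factorial : ℝ)) ≤ Real.exp (-x) * Real.exp x := by gcongr
    _ = 1 := by rw [← Real.exp_add]; simp

theorem integrable_poissonWeight (n : ℕ) :
    Integrable (fun x : Set.Ioi (0 : ℝ) => poissonWeight n x) volPos := by
  have h := Real.GammaIntegral_convergent (s := n + 1) (by positivity)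
  have h2 := (integrableOn_iff_comap_subtypeVal measurableSet_Ioi).1 h
  have h3 := h2.div_const (n.factorial : ℝ)
  refine h3.congr (Filter.Eventually.of_forall fun x => ?_)
  simp [poissonWeight]

theorem integral_poissonWeight (n : ℕ) :
    ∫ x : Set.Ioi (0 : ℝ), poissonWeight n x ∂volPos = 1 := by
  rw [volPos, integral_subtype_comap measurableSet_Ioi (poissonWeight n)]
  have h := Real.Gamma_eq_integral (s := n + 1) (by positivity)
  rw [Real.Gamma_nat_eq_factorial] at h
  simp only [add_sub_cancel_right, Real.rpow_natCast] at h
  simp only [poissonWeight]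
  rw [integral_div, ← h, div_self]
  exact_mod_cast n.factorial_ne_zero

theorem hasSum_poissonOp (e : HilbertBasis ℕ ℂ H) (s : Set.Ioi (0 : ℝ)) (x y : H) :
    HasSum (fun n => (poissonWeight n s : ℂ) * (⟪x, e n⟫_ℂ * ⟪e n, y⟫_ℂ))
      ⟪x, poissonOp e s y⟫_ℂ :=
  hasSum_shift e (c := fun n => poissonWeight n s)
    (fun n => by rw [abs_of_nonneg (poissonWeight_nonneg n s)]; exact poissonWeight_le_one n s)
    (σ := fun n => n) (τ := fun n => n) (fun _ _ h => h) (fun _ _ h => h) x y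

theorem integral_poissonOp (e : HilbertBasis ℕ ℂ H) (B : Set (Set.Ioi (0 : ℝ))) (x y : H) :
    Integrable (fun s : Set.Ioi (0 : ℝ) => ⟪x, poissonOp e s y⟫_ℂ) (volPos.restrict B) ∧
    HasSum (fun n => ((∫ s in B, poissonWeight n s ∂volPos : ℝ) : ℂ) * (⟪x, e n⟫_ℂ * ⟪e n, y⟫_ℂ))
      (∫ s in B, ⟪x, poissonOp e s y⟫_ℂ ∂volPos) := by
  have hint : ∀ n, Integrable (fun s : Set.Ioi (0 : ℝ) =>
      (poissonWeight n s : ℂ) * (⟪x, e n⟫_ℂ * ⟪e n, y⟫_ℂ)) (volPos.restrict B) := fun n =>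
    ((integrable_poissonWeight n).restrict.ofReal).mul_const _
  have hnorm : ∀ n, ∫ s in B, ‖(poissonWeight n (s : ℝ) : ℂ) * (⟪x, e n⟫_ℂ * ⟪e n, y⟫_ℂ)‖ ∂volPos ≤
      ‖⟪x, e n⟫_ℂ * ⟪e n, y⟫_ℂ‖ := fun n => by
    simp only [norm_mul (_ : ℂ) (_ * _), Complex.norm_real, Real.norm_eq_abs,
      abs_of_nonneg (poissonWeight_nonneg n _)]
    rw [integral_mul_const]
    refine mul_le_of_le_one_left (norm_nonneg _) ?_
    rw [← integral_poissonWeight n]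
    exact setIntegral_le_integral (integrable_poissonWeight n)
      (Filter.Eventually.of_forall fun s => poissonWeight_nonneg n s)
  have hsum : Summable fun n => ‖⟪x, e n⟫_ℂ * ⟪e n, y⟫_ℂ‖ :=
    (e.summable_inner_mul_inner x y).norm
  have hsum' : Summable fun n =>
      ∫ s in B, ‖(poissonWeight n (s : ℝ) : ℂ) * (⟪x, e n⟫_ℂ * ⟪e n, y⟫_ℂ)‖ ∂volPos :=
    Summable.of_nonneg_of_le (fun n => integral_nonneg fun s => norm_nonneg _) hnorm hsum
  constructor
  · refine ⟨?_, ?_⟩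
    · refine aestronglyMeasurable_of_tendsto_ae Filter.atTop
        (f := fun (N : ℕ) (s : Set.Ioi (0 : ℝ)) => ∑ n ∈ Finset.range N,
          (poissonWeight n s : ℂ) * (⟪x, e n⟫_ℂ * ⟪e n, y⟫_ℂ))
        (fun N => Finset.aestronglyMeasurable_fun_sum _ fun n _ => (hint n).1)
        (Filter.Eventually.of_forall fun s => (hasSum_poissonOp e s x y).tendsto_sum_nat)
    · rw [HasFiniteIntegral]
      calc ∫⁻ s in B, ‖⟪x, poissonOp e s y⟫_ℂ‖ₑ ∂volPos
          ≤ ∫⁻ s in B, (∑' n, ‖(poissonWeight n (s : ℝ) : ℂ) * (⟪x, e n⟫_ℂ * ⟪e n, y⟫_ℂ)‖ₑ) ∂volPos := by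
            refine lintegral_mono fun s => ?_
            show ‖⟪x, poissonOp e s y⟫_ℂ‖ₑ ≤ _
            rw [← (hasSum_poissonOp e s x y).tsum_eq]
            exact enorm_tsum_le_tsum_enorm
        _ = ∑' n, ∫⁻ s in B, ‖(poissonWeight n (s : ℝ) : ℂ) * (⟪x, e n⟫_ℂ * ⟪e n, y⟫_ℂ)‖ₑ ∂volPos :=
            lintegral_tsum fun n => (hint n).1.enorm
        _ = ∑' n, ENNReal.ofReal
              (∫ s in B, ‖(poissonWeight n (s : ℝ) : ℂ) * (⟪x, e n⟫_ℂ * ⟪e n, y⟫_ℂ)‖ ∂volPos) := by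
            simp only [ofReal_integral_norm_eq_lintegral_enorm (hint _)]
        _ < ⊤ := by
            rw [← ENNReal.ofReal_tsum_of_nonneg
              (fun n => integral_nonneg fun s => norm_nonneg _) hsum']
            exact ENNReal.ofReal_lt_top
  · have h := hasSum_integral_of_summable_integral_norm hint hsum'
    have h2 : ∀ s : Set.Ioi (0 : ℝ),
        ∑' n, (poissonWeight n s : ℂ) * (⟪x, e n⟫_ℂ * ⟪e n, y⟫_ℂ) = ⟪x, poissonOp e s y⟫_ℂ :=
      fun s => (hasSum_poissonOp e s x y).tsum_eq
    simp only [h2] at h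
    convert! h using 1
    funext n
    rw [integral_mul_const, integral_complex_ofReal]

theorem isWeakIntegral_poissonOp (e : HilbertBasis ℕ ℂ H) (B : Set (Set.Ioi (0 : ℝ))) :
    IsWeakIntegral (volPos.restrict B) (fun s : Set.Ioi (0 : ℝ) => poissonOp e s)
      (weakIntegral (volPos.restrict B) fun s : Set.Ioi (0 : ℝ) => poissonOp e s) := by
  refine isWeakIntegral_weakIntegral ⟨wotSum fun n : ℕ =>
    ((∫ s in B, poissonWeight n s ∂volPos : ℝ) : ℂ) • InnerProductSpace.rankOne ℂ (e n) (e n),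
    fun x y => ⟨(integral_poissonOp e B x y).1, ?_⟩⟩
  refine (hasSum_shift e (c := fun n => ∫ s in B, poissonWeight n s ∂volPos) (fun n => ?_)
    (σ := fun n => n) (τ := fun n => n) (fun _ _ h => h) (fun _ _ h => h) x y).unique
    (integral_poissonOp e B x y).2
  rw [abs_of_nonneg (integral_nonneg fun s => poissonWeight_nonneg n s),
    ← integral_poissonWeight n]
  exact setIntegral_le_integral (integrable_poissonWeight n)
    (Filter.Eventually.of_forall fun s => poissonWeight_nonneg n s)

open Classical in
/-- The POVM `E^X(B) = ∫_B F_x dx` on the Borel sets of `(0, ∞)`. -/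
def poissonPOVM (e : HilbertBasis ℕ ℂ H) : POVM H (Set.Ioi (0 : ℝ)) where
  toFun B := if MeasurableSet B then
    weakIntegral (volPos.restrict B) (fun x : Set.Ioi (0 : ℝ) => poissonOp e x) else 0
  not_measurable' B hB := if_neg hB
  nonneg' B hB := isPositive_iff_inner.2 fun x => by
    rw [if_pos hB, (isWeakIntegral_poissonOp e B x x).2]
    refine HasSum.nonneg (fun n => ?_) (integral_poissonOp e B x x).2
    rw [← inner_conj_symm x, ← Complex.normSq_eq_conj_mul_self, ← Complex.ofReal_mul]
    exact Complex.zero_le_real.2 (mul_nonneg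
      (integral_nonneg fun s => poissonWeight_nonneg n s) (Complex.normSq_nonneg _))
  univ' := ContinuousLinearMap.ext fun y => ext_inner_left ℂ fun x => by
    rw [if_pos MeasurableSet.univ, (isWeakIntegral_poissonOp e Set.univ x y).2,
      ← (integral_poissonOp e Set.univ x y).2.tsum_eq]
    simp only [Measure.restrict_univ, integral_poissonWeight, Complex.ofReal_one, one_mul]
    exact e.tsum_inner_mul_inner x y
  iUnion' B hB hd x y := by
    simp only [if_pos (hB _), if_pos (MeasurableSet.iUnion hB),
      (isWeakIntegral_poissonOp e _ x y).2]
    exact hasSum_integral_iUnion hB hd (integral_poissonOp e _ x y).1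




end Defs

end

end PhotonMeasurement

open PhotonMeasurement

namespace PhotonMeasurement

open MeasureTheory ProbabilityTheory
open scoped InnerProductSpace ComplexOrder

set_option linter.unusedSectionVars false

noncomputable section

variable {H : Type*} [NormedAddCommGroup H] [InnerProductSpace ℂ H] [CompleteSpace H]

/-! ### Diagonal operators -/

/-! Every Kraus operator of the two instruments maps a basis vector |n⟩ to a multiple of a basis
vector, and basis vectors with nonzero images under it go to different ones. So the instruments
preserve diagonal operators and act on the diagonal entries as a Markov chain in the photon number
(`krausMap_apply_basis`). The infinite composition must therefore be B ↦ ∑ₙ Pₙ(B) |n⟩⟨n|, where Pₙ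
is the law of the counts started from n photons. By `isInfiniteComposition_diagPOVM` it is enough to
exhibit probability measures Pₙ with the one-step recursion: a first count m has weight p(m|n), and
the later counts follow the law started from n - m (photon counting) or n + m (quantum counter).
Uniqueness is the π-λ theorem for initial cylinders, applied to the scalar measures of the POVM.

Both reference observables are diagonal as well: E^N has the Dirac measures, E^X the Gamma laws with
densities e^{-x} x^n / n!. For diagonal POVMs the relation ≼ follows from a kernel identity ν ∘ P =
Q (`fuzzier_diagPOVM`), so a pair of kernels settles each equivalence.

Photon counting, q = e^{-λt}: each photon is detected independently at step k with probability q^k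
(1 - q). This construction satisfies the recursion (`countingLaw_shift`), and as every photon is
eventually detected exactly once, the total count recovers n almost surely.

Quantum counter, a = e^{λt}: draw an intensity x from the Gamma law of n, then independent Poisson
counts with means x a^k (a - 1). Gamma-Poisson conjugacy gives the recursion
(`poissonWeight_mul_poissonWeight`): after a count m the rescaled intensity a x has the Gamma law of
n + m. The intensity is recovered as the almost sure limit of the normalized counts
(`ae_tendsto_poissonLaw`), so averaging over it loses nothing. -/

theorem ext_on_basis (e : HilbertBasis ℕ ℂ H) {S T : H →L[ℂ] H} (h : ∀ n, S (e n) = T (e n)) :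
    S = T :=
  ContinuousLinearMap.ext_on (Submodule.dense_iff_topologicalClosure_eq_top.2 e.dense_span) (by rintro _ ⟨n, rfl⟩; exact h n)

/-- The diagonal operator `∑ₙ cₙ |n⟩⟨n|`. -/
def diagOp (e : HilbertBasis ℕ ℂ H) (c : ℕ → ℝ) : H →L[ℂ] H :=
  wotSum fun n => (c n : ℂ) • InnerProductSpace.rankOne ℂ (e n) (e n)

theorem hasSum_diagOp (e : HilbertBasis ℕ ℂ H) {c : ℕ → ℝ} (hc : ∀ n, |c n| ≤ 1) (x y : H) :
    HasSum (fun n => (c n : ℂ) * (⟪x, e n⟫_ℂ * ⟪e n, y⟫_ℂ)) ⟪x, diagOp e c y⟫_ℂ :=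
  hasSum_shift e hc (σ := fun n => n) (τ := fun n => n) (fun _ _ h => h) (fun _ _ h => h) x y

theorem inner_basis (e : HilbertBasis ℕ ℂ H) (m n : ℕ) :
    ⟪e m, e n⟫_ℂ = if m = n then 1 else 0 :=
  orthonormal_iff_ite.1 e.orthonormal m n

theorem ext_inner_basis (e : HilbertBasis ℕ ℂ H) {x y : H} (h : ∀ n, ⟪e n, x⟫_ℂ = ⟪e n, y⟫_ℂ) :
    x = y := by
  refine ext_inner_left ℂ fun z => ?_
  rw [← e.tsum_inner_mul_inner z x, ← e.tsum_inner_mul_inner z y]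
  simp only [h]

theorem wotSum_shift_apply_of_eq (e : HilbertBasis ℕ ℂ H) {c : ℕ → ℝ} (hc : ∀ n, |c n| ≤ 1)
    {σ τ : ℕ → ℕ} (hσ : σ.Injective) (hτ : τ.Injective) (n : ℕ) :
    wotSum (fun n => (c n : ℂ) • InnerProductSpace.rankOne ℂ (e (σ n)) (e (τ n))) (e (τ n)) =
      (c n : ℂ) • e (σ n) := by
  refine ext_inner_basis e fun k => ?_
  rw [← (hasSum_shift e hc hσ hτ (e k) (e (τ n))).tsum_eq, tsum_eq_single n]
  · simp [inner_basis, e.orthonormal.1]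
  · intro m hm
    simp [inner_basis, hτ.ne hm]

theorem wotSum_shift_apply_of_notMem (e : HilbertBasis ℕ ℂ H) {c : ℕ → ℝ} (hc : ∀ n, |c n| ≤ 1)
    {σ τ : ℕ → ℕ} (hσ : σ.Injective) (hτ : τ.Injective) {k : ℕ} (hk : ∀ n, τ n ≠ k) :
    wotSum (fun n => (c n : ℂ) • InnerProductSpace.rankOne ℂ (e (σ n)) (e (τ n))) (e k) = 0 := by
  refine ext_inner_basis e fun j => ?_
  rw [← (hasSum_shift e hc hσ hτ (e j) (e k)).tsum_eq]
  simp [inner_basis, hk]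

theorem diagOp_apply (e : HilbertBasis ℕ ℂ H) {c : ℕ → ℝ} (hc : ∀ n, |c n| ≤ 1) (n : ℕ) :
    diagOp e c (e n) = (c n : ℂ) • e n :=
  wotSum_shift_apply_of_eq e hc (σ := fun n => n) (τ := fun n => n)
    (fun _ _ h => h) (fun _ _ h => h) n

theorem inner_mul_inner_self (x y : H) :
    ⟪x, y⟫_ℂ * ⟪y, x⟫_ℂ = ((‖⟪y, x⟫_ℂ‖ ^ 2 : ℝ) : ℂ) := by
  rw [← inner_conj_symm x, ← Complex.normSq_eq_conj_mul_self, Complex.normSq_eq_norm_sq]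

theorem hasSum_diagOp_self (e : HilbertBasis ℕ ℂ H) {c : ℕ → ℝ} (hc : ∀ n, |c n| ≤ 1) (x : H) :
    HasSum (fun n => ((c n * ‖⟪e n, x⟫_ℂ‖ ^ 2 : ℝ) : ℂ)) ⟪x, diagOp e c x⟫_ℂ := by
  convert! hasSum_diagOp e hc x x using 1
  funext n
  rw [inner_mul_inner_self, Complex.ofReal_mul]

/-! ### Diagonal POVMs -/

section Diag

variable {Ω : Type*} [MeasurableSpace Ω]

theorem abs_measureReal_le_one (μ : Measure Ω) [IsProbabilityMeasure μ] (B : Set Ω) :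
    |μ.real B| ≤ 1 := by
  rw [abs_of_nonneg measureReal_nonneg]
  exact measureReal_le_one

open Classical in
/-- The POVM `B ↦ ∑ₙ Pₙ(B) |n⟩⟨n|` of a sequence `P` of probability measures. -/
def diagPOVM (e : HilbertBasis ℕ ℂ H) (P : Kernel ℕ Ω) [IsMarkovKernel P] : POVM H Ω where
  toFun B := if MeasurableSet B then diagOp e (fun n => (P n).real B) else 0
  not_measurable' B hB := if_neg hB
  nonneg' B hB := by
    rw [if_pos hB]
    refine isPositive_iff_inner.2 fun x => ?_
    refine HasSum.nonneg (fun n => ?_)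
      (hasSum_diagOp_self e (fun n => abs_measureReal_le_one (P n) B) x)
    exact Complex.zero_le_real.2 (by positivity)
  univ' := by
    rw [if_pos MeasurableSet.univ]
    refine ext_on_basis e fun n => ?_
    rw [diagOp_apply e fun n => abs_measureReal_le_one (P n) _]
    simp
  iUnion' B hB hd x y := by
    simp only [if_pos (hB _), if_pos (MeasurableSet.iUnion hB)]
    have hz := (e.summable_inner_mul_inner x y).norm
    have hP : ∀ n, HasSum (fun i => (P n).real (B i)) ((P n).real (⋃ i, B i)) := fun n => by
      have h1 : Summable fun i => (P n).real (B i) :=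
        ENNReal.summable_toReal (by rw [← measure_iUnion hd hB]; exact measure_ne_top _ _)
      convert h1.hasSum using 1
      rw [measureReal_def, measure_iUnion hd hB,
        ENNReal.tsum_toReal_eq fun i => measure_ne_top _ _]
      rfl
    -- Absolute summability in both indices permits exchanging the sums over n and i. Summing over i
    -- first leaves Pₙ(⋃ Bᵢ) ≤ 1 times the summable |⟪x, eₙ⟫⟪eₙ, y⟫|.
    have hs : Summable (fun p : ℕ × ℕ =>
        (((P p.1).real (B p.2) : ℝ) : ℂ) * (⟪x, e p.1⟫_ℂ * ⟪e p.1, y⟫_ℂ)) := by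
      refine Summable.of_norm ((summable_prod_of_nonneg fun p => norm_nonneg _).2 ⟨fun n => ?_, ?_⟩)
      · simp only [norm_mul (_ : ℂ) (_ * _), Complex.norm_real, Real.norm_of_nonneg measureReal_nonneg]
        exact (hP n).summable.mul_right _
      · simp only [norm_mul (_ : ℂ) (_ * _), Complex.norm_real, Real.norm_of_nonneg measureReal_nonneg,
          tsum_mul_right, (hP _).tsum_eq]
        exact Summable.of_nonneg_of_le (fun n => by positivity)
          (fun n => mul_le_of_le_one_left (norm_nonneg _) measureReal_le_one) hz
    have h1 := hs.hasSum.prod_fiberwise fun n =>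
      (Complex.hasSum_ofReal.2 (hP n)).mul_right (⟪x, e n⟫_ℂ * ⟪e n, y⟫_ℂ)
    have h2 := hs.prod_symm.hasSum.prod_fiberwise fun i =>
      hasSum_diagOp e (fun n => abs_measureReal_le_one (P n) (B i)) x y
    rw [(hasSum_diagOp e (fun n => abs_measureReal_le_one (P n) (⋃ i, B i)) x y).unique h1]
    convert h2 using 1
    exact ((Equiv.prodComm ℕ ℕ).tsum_eq _).symm

variable (e : HilbertBasis ℕ ℂ H) (P : Kernel ℕ Ω) [IsMarkovKernel P]

theorem diagPOVM_apply {B : Set Ω} (hB : MeasurableSet B) :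
    diagPOVM e P B = diagOp e (fun n => (P n).real B) :=
  if_pos hB

theorem diagPOVM_apply_basis {B : Set Ω} (hB : MeasurableSet B) (n : ℕ) :
    diagPOVM e P B (e n) = (((P n).real B : ℝ) : ℂ) • e n := by
  rw [diagPOVM_apply e P hB, diagOp_apply e fun n => abs_measureReal_le_one (P n) B]

/-- Values on basis vectors determine bounded operators, and on non-measurable sets both POVMs are 0
by convention. This is how the two reference observables are recognized as diagonal. -/
theorem eq_diagPOVM {E : POVM H Ω}
    (h : ∀ B, MeasurableSet B → ∀ n, E B (e n) = (((P n).real B : ℝ) : ℂ) • e n) :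
    E = diagPOVM e P := by
  refine POVM.ext (funext fun B => ?_)
  by_cases hB : MeasurableSet B
  · exact ext_on_basis e fun n => (h B hB n).trans (diagPOVM_apply_basis e P hB n).symm
  · rw [E.not_measurable' B hB, (diagPOVM e P).not_measurable' B hB]

/-- Reduces operator integrals to scalar ones: in the vector x the outcomes follow the mixture of
the Pₙ with weights |⟪eₙ, x⟫|². -/
theorem measure_diagPOVM (x : H) :
    (diagPOVM e P).measure x =
      Measure.sum fun n => ENNReal.ofReal (‖⟪e n, x⟫_ℂ‖ ^ 2) • P n := by
  ext B hB
  have h := Complex.hasSum_re (hasSum_diagOp_self e (fun n => abs_measureReal_le_one (P n) B) x)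
  simp only [Complex.ofReal_re] at h
  rw [POVM.measure_apply _ _ hB, diagPOVM_apply e P hB, Measure.sum_apply _ hB, ← h.tsum_eq,
    ENNReal.ofReal_tsum_of_nonneg (fun n => by positivity) h.summable]
  refine tsum_congr fun n => ?_
  rw [ENNReal.ofReal_mul measureReal_nonneg, ofReal_measureReal, Measure.smul_apply, smul_eq_mul,
    mul_comm]

instance (E : POVM H Ω) (x : H) : IsFiniteMeasure (E.measure x) :=
  ⟨by rw [E.measure_apply x MeasurableSet.univ]; exact ENNReal.ofReal_lt_top⟩

theorem isIntegral_diagPOVM {f : Ω → ℝ} (hf : Measurable f) (hf0 : ∀ ω, 0 ≤ f ω)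
    (hf1 : ∀ ω, f ω ≤ 1) : (diagPOVM e P).IsIntegral f (diagOp e fun n => ∫ ω, f ω ∂(P n)) := by
  intro x
  have hint : ∀ μ : Measure Ω, IsFiniteMeasure μ → Integrable f μ := fun μ _ =>
    Integrable.of_bound hf.aestronglyMeasurable 1
      (Filter.Eventually.of_forall fun ω => by rw [Real.norm_of_nonneg (hf0 ω)]; exact hf1 ω)
  have hc : ∀ n, |∫ ω, f ω ∂(P n)| ≤ 1 := fun n => by
    rw [abs_of_nonneg (integral_nonneg hf0)]
    calc ∫ ω, f ω ∂(P n) ≤ ∫ _, (1 : ℝ) ∂(P n) :=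
          integral_mono (hint _ inferInstance) (integrable_const _) hf1
      _ = 1 := by simp
  have h1 := hasSum_diagOp_self e hc x
  have h2 := hasSum_integral_measure
    (measure_diagPOVM e P x ▸ hint ((diagPOVM e P).measure x) inferInstance)
  rw [measure_diagPOVM]
  refine h1.unique (Complex.hasSum_ofReal.2 ?_)
  convert! h2 using 1
  funext n
  rw [integral_smul_measure, ENNReal.toReal_ofReal (by positivity), smul_eq_mul, mul_comm]

/-- Post-processing the measures `Pₙ` by a Markov kernel makes the diagonal POVM fuzzier. -/
theorem fuzzier_diagPOVM {Ω' : Type*} [MeasurableSpace Ω'] (Q : Kernel ℕ Ω') [IsMarkovKernel Q]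
    (ν : Kernel Ω Ω') [IsMarkovKernel ν] (h : ν ∘ₖ P = Q) :
    (diagPOVM e Q).Fuzzier (diagPOVM e P) := by
  refine ⟨ν, inferInstance, fun B hB => ?_⟩
  have hm : Measurable fun ω => (ν ω).real B := (ν.measurable_coe hB).ennreal_toReal
  have := isIntegral_diagPOVM e P hm (fun ω => measureReal_nonneg) (fun ω => measureReal_le_one)
  convert this using 1
  rw [diagPOVM_apply e Q hB]
  congr 1
  funext n
  rw [← h, measureReal_def, Kernel.comp_apply' _ _ _ hB,
    ← integral_toReal (ν.measurable_coe hB).aemeasurable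
      (Filter.Eventually.of_forall fun ω => measure_lt_top _ _)]
  rfl

end Diag

/-! ### Infinite compositions -/

section Composition

variable {Ω : Type*} [MeasurableSpace Ω]

/-! ### Uniqueness of the infinite composition -/

theorem POVM.eq_of_measure_eq {E F : POVM H Ω} (h : ∀ x, E.measure x = F.measure x) : E = F := by
  refine POVM.ext (funext fun B => ?_)
  by_cases hB : MeasurableSet B
  · have key : ∀ x, ⟪x, E B x⟫_ℂ = ⟪x, F B x⟫_ℂ := fun x => by
      have h1 := Complex.nonneg_iff.1 ((E.nonneg' B hB).inner_nonneg_right x)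
      have h2 := Complex.nonneg_iff.1 ((F.nonneg' B hB).inner_nonneg_right x)
      have h3 := congrArg (fun μ : Measure Ω => μ B) (h x)
      simp only [POVM.measure_apply _ _ hB] at h3
      refine Complex.ext ((ENNReal.ofReal_eq_ofReal_iff h1.1 h2.1).1 h3) (h1.2.symm.trans h2.2)
    exact le_antisymm (le_iff_inner.2 fun x => by rw [key, sub_self])
      (le_iff_inner.2 fun x => by rw [key, sub_self])
  · rw [E.not_measurable' B hB, F.not_measurable' B hB]

/-- The sets `B₁ × ⋯ × Bₙ × Ω^∞`. -/
def initialCylinders (Ω : Type*) [MeasurableSpace Ω] : Set (Set (ℕ → Ω)) :=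
  {S | ∃ n, 1 ≤ n ∧ ∃ B : Fin n → Set Ω, (∀ i, MeasurableSet (B i)) ∧
    S = {ω | ∀ i : Fin n, ω i ∈ B i}}

/-- Sides indexed by ℕ instead of `Fin n` let cylinders of different lengths be padded with the full
space and intersected. -/
theorem mem_initialCylinders_iff {S : Set (ℕ → Ω)} : S ∈ initialCylinders Ω ↔
    ∃ n, 1 ≤ n ∧ ∃ B : ℕ → Set Ω, (∀ i, MeasurableSet (B i)) ∧ S = {ω | ∀ i < n, ω i ∈ B i} := by
  constructor
  · rintro ⟨n, hn, B, hB, rfl⟩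
    refine ⟨n, hn, fun i => if h : i < n then B ⟨i, h⟩ else Set.univ, fun i => ?_, ?_⟩
    · dsimp only
      split_ifs
      exacts [hB _, MeasurableSet.univ]
    · ext ω
      refine ⟨fun h i hi => ?_, fun h i => ?_⟩
      · dsimp only
        rw [dif_pos hi]
        exact h ⟨i, hi⟩
      · have := h i i.2
        dsimp only at this
        rwa [dif_pos i.2] at this
  · rintro ⟨n, hn, B, hB, rfl⟩
    exact ⟨n, hn, fun i => B i, fun i => hB _, Set.ext fun ω =>
      ⟨fun h i => h i i.2, fun h i hi => h ⟨i, hi⟩⟩⟩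

theorem isPiSystem_initialCylinders : IsPiSystem (initialCylinders Ω) := by
  intro S hS T hT _
  rw [mem_initialCylinders_iff] at *
  obtain ⟨n, hn, B, hB, rfl⟩ := hS
  obtain ⟨m, hm, C, hC, rfl⟩ := hT
  classical
  refine ⟨max n m, by omega, fun i => (if i < n then B i else Set.univ) ∩
    (if i < m then C i else Set.univ), fun i => ?_, ?_⟩
  · refine MeasurableSet.inter ?_ ?_ <;> split_ifs
    exacts [hB _, MeasurableSet.univ, hC _, MeasurableSet.univ]
  · ext ω
    simp only [Set.mem_inter_iff, Set.mem_ofPred_eq]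
    refine ⟨fun h i hi => ⟨?_, ?_⟩, fun h => ⟨fun i hi => ?_, fun i hi => ?_⟩⟩
    · split_ifs with h'
      exacts [h.1 i h', trivial]
    · split_ifs with h'
      exacts [h.2 i h', trivial]
    · have := (h i (by omega)).1
      rwa [if_pos hi] at this
    · have := (h i (by omega)).2
      rwa [if_pos hi] at this

theorem measurableSet_initialCylinder {n : ℕ} {B : Fin n → Set Ω} (hB : ∀ i, MeasurableSet (B i)) :
    MeasurableSet {ω : ℕ → Ω | ∀ i : Fin n, ω i ∈ B i} := by
  rw [Set.ofPred_forall]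
  exact MeasurableSet.iInter fun i => measurable_pi_apply _ (hB i)

theorem generateFrom_initialCylinders :
    MeasurableSpace.generateFrom (initialCylinders Ω) = MeasurableSpace.pi := by
  refine le_antisymm (MeasurableSpace.generateFrom_le ?_) ?_
  · rintro _ ⟨n, _, B, hB, rfl⟩
    exact measurableSet_initialCylinder hB
  · refine iSup_le fun i => ?_
    rintro _ ⟨B, hB, rfl⟩
    refine MeasurableSpace.measurableSet_generateFrom (mem_initialCylinders_iff.2
      ⟨i + 1, by omega, fun j => if j = i then B else Set.univ, fun j => ?_, ?_⟩)
    · dsimp only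
      split_ifs
      exacts [hB, MeasurableSet.univ]
    · ext ω
      refine ⟨fun h j _ => ?_, fun h => ?_⟩
      · dsimp only
        split_ifs with hj
        · subst hj; exact h
        · trivial
      · have := h i (by omega)
        dsimp only at this
        rwa [if_pos rfl] at this

theorem CPInstrument.IsInfiniteComposition.unique {I : CPInstrument H Ω} {E F : POVM H (ℕ → Ω)}
    (hE : I.IsInfiniteComposition E) (hF : I.IsInfiniteComposition F) : E = F := by
  refine POVM.eq_of_measure_eq fun x => ?_
  refine ext_of_generate_finite (initialCylinders Ω) generateFrom_initialCylinders.symm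
    isPiSystem_initialCylinders ?_ ?_
  · rintro _ ⟨n, hn, B, hB, rfl⟩
    have hm := measurableSet_initialCylinder hB
    rw [E.measure_apply x hm, F.measure_apply x hm, hE n hn B hB, hF n hn B hB]
  · rw [E.measure_apply x MeasurableSet.univ, F.measure_apply x MeasurableSet.univ, E.univ', F.univ']

/-- An instrument whose Kraus operators map basis vectors to multiples of basis vectors acts on
diagonal operators like a Markov chain. -/
theorem krausMap_apply_basis (e : HilbertBasis ℕ ℂ H) {K : ℕ → H →L[ℂ] H}
    (hK : ∀ x, HasSum (fun m => ‖K m x‖ ^ 2) (‖x‖ ^ 2)) {c : ℕ → ℕ → ℝ} {s : ℕ → ℕ → ℕ}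
    (hKe : ∀ m n, K m (e n) = (c m n : ℂ) • e (s m n))
    (hs : ∀ m n k, c m n ≠ 0 → c m k ≠ 0 → s m n = s m k → n = k)
    {b : H →L[ℂ] H} {d : ℕ → ℝ} (hb : ∀ n, b (e n) = (d n : ℂ) • e n) (B : Set ℕ) (n : ℕ) :
    krausMap K hK B b (e n) = ((∑' m : B, c m n ^ 2 * d (s m n) : ℝ) : ℂ) • e n := by
  refine ext_inner_basis e fun k => ?_
  rw [inner_krausMap, inner_smul_right, Complex.ofReal_tsum, ← tsum_mul_right]
  refine tsum_congr fun m => ?_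
  simp only [hKe, map_smul, hb, inner_smul_left, inner_smul_right, Complex.conj_ofReal, inner_basis]
  -- Off-diagonal entries vanish: if both coefficients are nonzero, `hs` makes the images of |k⟩ and
  -- |n⟩ distinct basis vectors, hence orthogonal.
  by_cases hkn : k = n
  · subst hkn
    simp only [if_true]
    push_cast
    ring
  · rw [if_neg hkn]
    by_cases h1 : c m k = 0
    · simp [h1]
    by_cases h2 : c m n = 0
    · simp [h2]
    rw [if_neg fun h => hkn (hs m k n h1 h2 h)]
    simp

/-- A sequence of measures on `ℕ^∞` that decomposes with respect to the first coordinate like the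
Markov chain of an instrument gives the infinite composition of the instrument. -/
theorem isInfiniteComposition_diagPOVM (e : HilbertBasis ℕ ℂ H) {K : ℕ → H →L[ℂ] H}
    (hK : ∀ x, HasSum (fun m => ‖K m x‖ ^ 2) (‖x‖ ^ 2)) {c : ℕ → ℕ → ℝ} {s : ℕ → ℕ → ℕ}
    (hKe : ∀ m n, K m (e n) = (c m n : ℂ) • e (s m n))
    (hs : ∀ m n k, c m n ≠ 0 → c m k ≠ 0 → s m n = s m k → n = k)
    (P : Kernel ℕ (ℕ → ℕ)) [IsMarkovKernel P]
    (hP : ∀ m n k (B : Fin k → Set ℕ), P n {ω | ω 0 = m ∧ ∀ i : Fin k, ω (i + 1) ∈ B i} =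
      ENNReal.ofReal (c m n ^ 2) * P (s m n) {ω | ∀ i : Fin k, ω i ∈ B i}) :
    (krausInstrument K hK).IsInfiniteComposition (diagPOVM e P) := by
  -- The case k = 0, not part of the defining property, starts the induction. In the step the
  -- outermost map belongs to the first count, so the cylinder is split according to its value.
  have key : ∀ k (B : Fin k → Set ℕ) n, (krausInstrument K hK).iterate k B (e n) =
      (((P n).real {ω | ∀ i : Fin k, ω i ∈ B i} : ℝ) : ℂ) • e n := by
    intro k
    induction k with
    | zero =>
      intro B n
      simp [CPInstrument.iterate]
    | succ k ih =>
      intro B n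
      refine (krausMap_apply_basis e hK hKe hs (ih fun i => B i.succ) (B 0) n).trans ?_
      congr 2
      have hset : {ω : ℕ → ℕ | ∀ i : Fin (k + 1), ω i ∈ B i} =
          ⋃ m : B 0, {ω | ω 0 = (m : ℕ) ∧ ∀ i : Fin k, ω (i + 1) ∈ B i.succ} := by
        ext ω
        simp [Fin.forall_fin_succ]
      rw [hset, measureReal_def, measure_iUnion, ENNReal.tsum_toReal_eq fun m => measure_ne_top _ _]
      · refine tsum_congr fun m => ?_
        rw [hP, ENNReal.toReal_mul, ENNReal.toReal_ofReal (by positivity)]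
        rfl
      · intro m m' hm
        refine Set.disjoint_left.2 fun ω h1 h2 => hm (Subtype.ext ?_)
        exact h1.1.symm.trans h2.1
      · intro m
        have : {ω : ℕ → ℕ | ω 0 = (m : ℕ) ∧ ∀ i : Fin k, ω (i + 1) ∈ B i.succ} =
            {ω | ω 0 = (m : ℕ)} ∩ ⋂ i : Fin k, {ω | ω (i + 1) ∈ B i.succ} := by
          ext; simp
        rw [this]
        have h0 : ∀ i, Measurable fun ω : ℕ → ℕ => ω i := fun i => measurable_pi_apply i
        exact (h0 0 (MeasurableSet.singleton (m : ℕ))).inter (MeasurableSet.iInter fun i : Fin k =>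
          h0 (i + 1) (MeasurableSet.of_discrete (s := B i.succ)))
  intro k _ B hB
  refine ext_on_basis e fun n => ?_
  rw [key, diagPOVM_apply_basis e P (measurableSet_initialCylinder hB)]

end Composition

/-! ### The photon counting measurement -/

theorem pcProb_of_lt (lam t : ℝ) {m n : ℕ} (h : n < m) : pcProb lam t m n = 0 := by
  simp [pcProb, Nat.choose_eq_zero_of_lt h]

/-- With no count in the first step, the additional photon must have escaped detection, which has
probability e^{-λt}. -/
theorem pcProb_zero_succ (lam t : ℝ) (n : ℕ) :
    pcProb lam t 0 (n + 1) = Real.exp (-(lam * t)) * pcProb lam t 0 n := by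
  simp only [pcProb, Nat.choose_zero_right, Nat.cast_one, pow_zero, one_mul]
  rw [← Real.exp_add]
  congr 1
  push_cast
  ring

/-- Condition on whether the additional photon is detected in the first step. Algebraically this is
Pascal's rule. -/
theorem pcProb_succ_succ (lam t : ℝ) (m n : ℕ) :
    pcProb lam t (m + 1) (n + 1) = (1 - Real.exp (-(lam * t))) * pcProb lam t m n +
      Real.exp (-(lam * t)) * pcProb lam t (m + 1) n := by
  have h : Real.exp (-(lam * t) * ((n : ℝ) - m)) =
      Real.exp (-(lam * t)) * Real.exp (-(lam * t) * ((n : ℝ) - (m + 1))) := by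
    rw [← Real.exp_add]
    congr 1
    ring
  simp only [pcProb, Nat.choose_succ_succ]
  push_cast
  rw [show (n : ℝ) + 1 - (m + 1) = n - m by ring, h]
  ring

/-- For n < m the truncated difference n - m is meaningless, but harmless: the coefficient is then
0. -/
theorem pcOp_apply_basis (e : HilbertBasis ℕ ℂ H) {lam t : ℝ} (h : 0 < lam * t) (m n : ℕ) :
    pcOp e lam t m (e n) = ((√(pcProb lam t m n) : ℝ) : ℂ) • e (n - m) := by
  have hc : ∀ k, |√(pcProb lam t m (m + k))| ≤ 1 := fun k => by
    rw [abs_of_nonneg (Real.sqrt_nonneg _)]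
    exact Real.sqrt_le_one.2 (pcProb_le_one h m k)
  rcases lt_or_ge n m with hn | hn
  · rw [pcProb_of_lt _ _ hn, Real.sqrt_zero, Complex.ofReal_zero, zero_smul]
    exact wotSum_shift_apply_of_notMem e hc (σ := fun k => k) (τ := fun k => k + m)
      (fun _ _ h => h) (add_left_injective m) fun k => by omega
  · obtain ⟨k, rfl⟩ := Nat.exists_eq_add_of_le' hn
    rw [Nat.add_sub_cancel, add_comm k m]
    have := wotSum_shift_apply_of_eq e hc (σ := fun k => k) (τ := fun k => k + m)
      (fun _ _ h => h) (add_left_injective m) k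
    simp only [add_comm k m] at this
    exact this

/-- The law of the counts when each of `n` photons is, independently, detected at the `k`-th step
with probability `q^k (1 - q)`. -/
def countingLaw (q : ℝ) : ℕ → Measure (ℕ → ℕ)
  | 0 => Measure.dirac 0
  | n + 1 => Measure.sum fun k => ENNReal.ofReal (q ^ k * (1 - q)) •
      (countingLaw q n).map fun ω => ω + Pi.single k 1

theorem measurable_add_single (k : ℕ) : Measurable fun ω : ℕ → ℕ => ω + Pi.single k 1 :=
  measurable_pi_lambda _ fun i =>
    (measurable_of_countable fun m : ℕ => m + (Pi.single k 1 : ℕ → ℕ) i).comp (measurable_pi_apply i)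

theorem measurable_shift : Measurable fun (ω : ℕ → ℕ) i => ω (i + 1) :=
  measurable_pi_lambda _ fun i => measurable_pi_apply (i + 1)

theorem countingLaw_succ_apply (q : ℝ) (n : ℕ) {S : Set (ℕ → ℕ)} (hS : MeasurableSet S) :
    countingLaw q (n + 1) S = ∑' k, ENNReal.ofReal (q ^ k * (1 - q)) *
      countingLaw q n ((fun ω => ω + Pi.single k 1) ⁻¹' S) := by
  rw [countingLaw, Measure.sum_apply _ hS]
  refine tsum_congr fun k => ?_
  rw [Measure.smul_apply, Measure.map_apply (measurable_add_single k) hS, smul_eq_mul]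

theorem isProbabilityMeasure_countingLaw {q : ℝ} (h0 : 0 ≤ q) (h1 : q < 1) (n : ℕ) :
    IsProbabilityMeasure (countingLaw q n) := by
  induction n with
  | zero => exact inferInstanceAs (IsProbabilityMeasure (Measure.dirac 0))
  | succ n ih =>
    have hs := (hasSum_geometric_of_lt_one h0 h1).mul_right (1 - q)
    rw [inv_mul_cancel₀ (by linarith)] at hs
    constructor
    rw [countingLaw_succ_apply q n MeasurableSet.univ]
    simp only [Set.preimage_univ, measure_univ, mul_one]
    rw [← ENNReal.ofReal_tsum_of_nonneg (fun k => mul_nonneg (pow_nonneg h0 k) (by linarith))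
      hs.summable, hs.tsum_eq, ENNReal.ofReal_one]

theorem measurableSet_zero_eq_and_shift_mem (m : ℕ) {C : Set (ℕ → ℕ)} (hC : MeasurableSet C) :
    MeasurableSet {ω : ℕ → ℕ | ω 0 = m ∧ (fun i => ω (i + 1)) ∈ C} :=
  ((measurable_pi_apply 0 : Measurable fun ω : ℕ → ℕ => ω 0) (MeasurableSet.singleton m)).inter
    (measurable_shift hC)

theorem preimage_add_single_zero (C : Set (ℕ → ℕ)) (m : ℕ) :
    (fun ω : ℕ → ℕ => ω + Pi.single 0 1) ⁻¹' {ω | ω 0 = m ∧ (fun i => ω (i + 1)) ∈ C} =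
      {ω | ω 0 + 1 = m ∧ (fun i => ω (i + 1)) ∈ C} := by
  ext ω
  simp

/-- A photon detected at step k + 1 leaves the first count alone and is one detected at step k of
the shifted sequence. -/
theorem preimage_add_single_succ (C : Set (ℕ → ℕ)) (m k : ℕ) :
    (fun ω : ℕ → ℕ => ω + Pi.single (k + 1) 1) ⁻¹' {ω | ω 0 = m ∧ (fun i => ω (i + 1)) ∈ C} =
      {ω | ω 0 = m ∧ (fun i => ω (i + 1)) ∈ (fun ω : ℕ → ℕ => ω + Pi.single k 1) ⁻¹' C} := by
  ext ω
  have : (fun i => ω (i + 1) + (Pi.single (k + 1) 1 : ℕ → ℕ) (i + 1)) =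
      (fun i => ω (i + 1)) + Pi.single k 1 := by
    funext i
    simp [Pi.single_apply]
  simp [this]

/-- The one-step recursion, by induction on the number of photons. Condition on the step at which
the last photon is detected: the first step gives one term of the recursion for `pcProb`, all later
steps together give the other. -/
theorem countingLaw_shift {lam t : ℝ} (h : 0 < lam * t) (n m : ℕ) {C : Set (ℕ → ℕ)}
    (hC : MeasurableSet C) :
    countingLaw (Real.exp (-(lam * t))) n {ω | ω 0 = m ∧ (fun i => ω (i + 1)) ∈ C} =
      ENNReal.ofReal (pcProb lam t m n) * countingLaw (Real.exp (-(lam * t))) (n - m) C := by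
  set q := Real.exp (-(lam * t)) with hq
  have hq0 : 0 ≤ q := (Real.exp_pos _).le
  have hq1 : 0 ≤ 1 - q := by
    rw [sub_nonneg, hq, Real.exp_le_one_iff]; linarith
  induction n generalizing m C with
  | zero =>
    rw [Nat.zero_sub, countingLaw, Measure.dirac_apply' _ (measurableSet_zero_eq_and_shift_mem m hC),
      Measure.dirac_apply' _ hC]
    rcases m with _ | m
    · have : pcProb lam t 0 0 = 1 := by simp [pcProb]
      classical
      rw [this, ENNReal.ofReal_one, one_mul, Set.indicator_apply, Set.indicator_apply]
      refine if_congr ⟨fun h => h.2, fun h => ⟨rfl, h⟩⟩ rfl rfl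
    · rw [pcProb_of_lt _ _ (Nat.succ_pos m), ENNReal.ofReal_zero, zero_mul, Set.indicator_of_notMem]
      intro h
      exact absurd h.1 (by simp)
  | succ n ih =>
    rw [countingLaw_succ_apply _ _ (measurableSet_zero_eq_and_shift_mem m hC),
      tsum_eq_zero_add' ENNReal.summable, preimage_add_single_zero, pow_zero, one_mul]
    -- The geometric law has no memory: a photon missed in the first step, with probability q, joins
    -- the n - m remaining ones on equal terms, making n - m + 1.
    have htail : ∑' k, ENNReal.ofReal (q ^ (k + 1) * (1 - q)) * countingLaw q n
        ((fun ω => ω + Pi.single (k + 1) 1) ⁻¹' {ω | ω 0 = m ∧ (fun i => ω (i + 1)) ∈ C}) =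
        ENNReal.ofReal q * ENNReal.ofReal (pcProb lam t m n) * countingLaw q (n - m + 1) C := by
      rw [countingLaw_succ_apply _ _ hC, ← ENNReal.tsum_mul_left]
      refine tsum_congr fun k => ?_
      rw [preimage_add_single_succ, ih m (measurable_add_single k hC), pow_succ', mul_assoc q,
        ENNReal.ofReal_mul hq0]
      ring
    rw [htail]
    rcases m with _ | m
    · have : {ω : ℕ → ℕ | ω 0 + 1 = 0 ∧ (fun i => ω (i + 1)) ∈ C} = ∅ := by ext; simp
      rw [this, measure_empty, mul_zero, zero_add, pcProb_zero_succ, ENNReal.ofReal_mul hq0]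
      rfl
    · simp only [Nat.add_right_cancel_iff]
      rw [ih m hC, pcProb_succ_succ, ENNReal.ofReal_add (mul_nonneg hq1 (pcProb_nonneg h _ _))
        (mul_nonneg hq0 (pcProb_nonneg h _ _)), ENNReal.ofReal_mul hq1, ENNReal.ofReal_mul hq0,
        Nat.add_sub_add_right, add_mul, mul_assoc (ENNReal.ofReal (1 - q))]
      congr 1
      -- The photon numbers n - (m + 1) + 1 and n - m differ only when n < m + 1, by truncated
      -- subtraction; then the factor `pcProb lam t (m + 1) n` is 0.
      rcases lt_or_ge n (m + 1) with hn | hn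
      · simp [pcProb_of_lt _ _ hn]
      · rw [show n - (m + 1) + 1 = n - m by omega]

/-- Each photon adds a unit sequence, so it contributes exactly one count in total. Summing in
`ENNReal` avoids any question of convergence. -/
theorem ae_tsum_eq_countingLaw (q : ℝ) (n : ℕ) :
    ∀ᵐ ω ∂(countingLaw q n), ∑' i, (ω i : ENNReal) = n := by
  have hm : ∀ n : ℕ, MeasurableSet {ω : ℕ → ℕ | ∑' i, (ω i : ENNReal) = n} := fun n =>
    (Measurable.tsum fun i => (measurable_of_countable
      fun m : ℕ => (m : ENNReal)).comp (measurable_pi_apply i)) (MeasurableSet.singleton (n : ENNReal))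
  induction n with
  | zero =>
    rw [countingLaw, ae_dirac_iff (hm _)]
    simp
  | succ n ih =>
    rw [countingLaw, Measure.ae_sum_iff]
    refine fun k => Measure.ae_smul_measure ?_ _
    rw [ae_map_iff (measurable_add_single k).aemeasurable (hm _)]
    filter_upwards [ih] with ω hω
    have : ∑' i, ((Pi.single k 1 : ℕ → ℕ) i : ENNReal) = 1 := by
      rw [tsum_eq_single k fun i hi => by simp [hi]]
      simp
    simp only [Pi.add_apply, Nat.cast_add]
    rw [ENNReal.tsum_add, hω, this, Nat.cast_one]

/-- The total number of counts. -/
def totalCount (ω : ℕ → ℕ) : ℕ := ⌊(∑' i, (ω i : ENNReal)).toReal⌋₊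

theorem measurable_totalCount : Measurable totalCount :=
  Nat.measurable_floor.comp (Measurable.tsum fun i => (measurable_of_countable
    fun m : ℕ => (m : ENNReal)).comp (measurable_pi_apply i)).ennreal_toReal

/-- The laws of the counts, as a kernel in the initial photon number. -/
def countingKernel (q : ℝ) : Kernel ℕ (ℕ → ℕ) := Kernel.ofFunOfCountable (countingLaw q)

theorem isMarkovKernel_countingKernel {q : ℝ} (h0 : 0 ≤ q) (h1 : q < 1) :
    IsMarkovKernel (countingKernel q) :=
  ⟨isProbabilityMeasure_countingLaw h0 h1⟩

theorem deterministic_totalCount_comp {q : ℝ} (h0 : 0 ≤ q) (h1 : q < 1) :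
    Kernel.deterministic totalCount measurable_totalCount ∘ₖ countingKernel q = Kernel.id := by
  refine Kernel.ext fun n => ?_
  have := isProbabilityMeasure_countingLaw h0 h1 n
  rw [Kernel.deterministic_comp_eq_map, Kernel.map_apply _ measurable_totalCount, Kernel.id_apply]
  have h : totalCount =ᵐ[countingLaw q n] fun _ => n := by
    filter_upwards [ae_tsum_eq_countingLaw q n] with ω hω
    simp [totalCount, hω]
  refine (Measure.map_congr h).trans ?_
  rw [Measure.map_const, measure_univ, one_smul]

theorem numberPOVM_eq_diagPOVM (e : HilbertBasis ℕ ℂ H) :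
    numberPOVM e = diagPOVM e Kernel.id := by
  refine eq_diagPOVM e _ fun B hB n => ext_inner_basis e fun k => ?_
  refine (hasSum_number e B (e k) (e n)).tsum_eq.symm.trans ?_
  rw [tsum_subtype B fun m => ⟪e k, e m⟫_ℂ * ⟪e m, e n⟫_ℂ, tsum_eq_single n]
  · rw [Kernel.id_apply, measureReal_def, Measure.dirac_apply' _ hB, inner_smul_right]
    by_cases hn : n ∈ B <;> simp [hn, inner_basis]
  · intro m hm
    simp [inner_basis, hm]

theorem exists_pcInstrument_composition (e : HilbertBasis ℕ ℂ H) {lam t : ℝ} (hlam : 0 < lam)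
    (ht : 0 < t) : ∃ E : POVM H (ℕ → ℕ), (pcInstrument e hlam ht).IsInfiniteComposition E ∧
      E.FuzzyEquiv (numberPOVM e) := by
  have h := mul_pos hlam ht
  have h0 := (Real.exp_pos (-(lam * t))).le
  have h1 : Real.exp (-(lam * t)) < 1 := by rw [Real.exp_lt_one_iff]; linarith
  have := isMarkovKernel_countingKernel h0 h1
  refine ⟨diagPOVM e (countingKernel (Real.exp (-(lam * t)))), ?_, ?_⟩
  · refine isInfiniteComposition_diagPOVM e (hasSum_pcOp e hlam ht)
      (pcOp_apply_basis e h) (fun m n k hn hk hnk => ?_) _ fun m n k B => ?_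
    -- A nonzero coefficient forces m ≤ j, and on such j truncated subtraction of m is injective.
    · have hle : ∀ j, √(pcProb lam t m j) ≠ 0 → m ≤ j := fun j hj => by
        by_contra hlt
        exact hj (by rw [pcProb_of_lt _ _ (not_le.1 hlt), Real.sqrt_zero])
      have := hle n hn
      have := hle k hk
      omega
    · rw [Real.sq_sqrt (pcProb_nonneg h _ _)]
      exact countingLaw_shift h n m (measurableSet_initialCylinder fun _ => MeasurableSet.of_discrete)
  · rw [numberPOVM_eq_diagPOVM]
    -- One direction simulates the counts from the photon number; the other sums the counts.
    exact ⟨fuzzier_diagPOVM e _ _ (countingKernel _) (Kernel.comp_id _),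
      fuzzier_diagPOVM e _ _ _ (deterministic_totalCount_comp h0 h1)⟩

/-! ### The quantum counter measurement -/

theorem qcProb_le_one {lam t : ℝ} (h : 0 < lam * t) (m n : ℕ) : qcProb lam t m n ≤ 1 :=
  le_hasSum (hasSum_qcProb h n) m fun k _ => qcProb_nonneg h k n

theorem qcOp_apply_basis (e : HilbertBasis ℕ ℂ H) {lam t : ℝ} (h : 0 < lam * t) (m n : ℕ) :
    qcOp e lam t m (e n) = ((√(qcProb lam t m n) : ℝ) : ℂ) • e (n + m) :=
  wotSum_shift_apply_of_eq e (c := fun n => √(qcProb lam t m n))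
    (fun n => by
      rw [abs_of_nonneg (Real.sqrt_nonneg _)]
      exact Real.sqrt_le_one.2 (qcProb_le_one h m n))
    (σ := fun k => k + m) (τ := fun k => k) (add_left_injective m) (fun _ _ h => h) n

/-! ### Poisson counts with a given intensity -/

theorem measurable_poissonMeasure_apply (B : Set ℕ) :
    Measurable fun r : NNReal => poissonMeasure r B := by
  have : ∀ r : NNReal, poissonMeasure r B = ∑' n : ℕ,
      ENNReal.ofReal (Real.exp (-r) * r ^ n / n.factorial) * Measure.dirac n B := fun r => by
    rw [poissonMeasure, Measure.sum_apply _ MeasurableSet.of_discrete]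
    rfl
  simp only [this]
  refine Measurable.tsum fun n => Measurable.mul_const ?_ _
  fun_prop

/-- The mean number of counts at step `k` when the intensity is `x` and the amplification
factor is `a`. -/
def countMean (a x : ℝ) (k : ℕ) : NNReal := (x * (a ^ k * (a - 1))).toNNReal

/-- Dropping the first count amounts to amplifying the intensity from x to a x. -/
theorem countMean_succ (a x : ℝ) (k : ℕ) : countMean a x (k + 1) = countMean a (a * x) k := by
  unfold countMean
  congr 1
  ring

/-- The law of a sequence of independent Poisson variables with means `countMean a x`. -/
def poissonLaw (a x : ℝ) : Measure (ℕ → ℕ) :=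
  Measure.infinitePi fun k => poissonMeasure (countMean a x k)

instance (a x : ℝ) : IsProbabilityMeasure (poissonLaw a x) :=
  inferInstanceAs (IsProbabilityMeasure (Measure.infinitePi _))

theorem poissonLaw_initialCylinder (a x : ℝ) {n : ℕ} (B : Fin n → Set ℕ) :
    poissonLaw a x {ω | ∀ i : Fin n, ω i ∈ B i} =
      ∏ i : Fin n, poissonMeasure (countMean a x i) (B i) := by
  have h := Measure.infinitePi_pi (fun k => poissonMeasure (countMean a x k))
    (s := Finset.range n) (t := fun i => if h : i < n then B ⟨i, h⟩ else Set.univ)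
    fun _ _ => MeasurableSet.of_discrete
  rw [Finset.prod_range] at h
  simp only [Fin.is_lt, dite_true, Fin.eta] at h
  rw [← h, poissonLaw]
  congr 1
  ext ω
  refine ⟨fun h i hi => ?_, fun h i => ?_⟩
  · have hi' := Finset.mem_range.1 (Finset.mem_coe.1 hi)
    simp only [hi', dite_true]
    exact h ⟨i, hi'⟩
  · have := h i (by simp)
    simpa using this

theorem measurable_countMean (a : ℝ) (k : ℕ) : Measurable fun x => countMean a x k := by
  unfold countMean
  fun_prop

theorem measurable_poissonLaw (a : ℝ) : Measurable (poissonLaw a) := by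
  refine Measurable.measure_of_isPiSystem_of_isProbabilityMeasure
    generateFrom_initialCylinders.symm isPiSystem_initialCylinders ?_
  rintro _ ⟨n, _, B, _, rfl⟩
  simp only [poissonLaw_initialCylinder]
  exact Finset.measurable_fun_prod _ fun i _ =>
    (measurable_poissonMeasure_apply (B i)).comp (measurable_countMean a i)

/-- Independence splits off the first count; the remaining means are those of the amplified
intensity. -/
theorem poissonLaw_shift (a x : ℝ) (m : ℕ) {k : ℕ} (B : Fin k → Set ℕ) :
    poissonLaw a x {ω | ω 0 = m ∧ ∀ i : Fin k, ω (i + 1) ∈ B i} =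
      poissonMeasure (countMean a x 0) {m} * poissonLaw a (a * x) {ω | ∀ i : Fin k, ω i ∈ B i} := by
  have h := poissonLaw_initialCylinder a x (Fin.cons {m} B : Fin (k + 1) → Set ℕ)
  rw [Fin.prod_univ_succ] at h
  simp only [Fin.cons_zero, Fin.cons_succ, Fin.val_zero, Fin.val_succ, countMean_succ] at h
  rw [← poissonLaw_initialCylinder] at h
  rw [← h]
  congr 1
  ext ω
  simp [Fin.forall_fin_succ]

/-! ### Gamma mixtures of the Poisson laws -/

theorem measurable_poissonWeight (n : ℕ) : Measurable (poissonWeight n) := by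
  unfold poissonWeight
  fun_prop

/-- The Gamma distributions on `(0, ∞)` with the densities `e^{-x} x^n / n!`. -/
def gammaKernel : Kernel ℕ (Set.Ioi (0 : ℝ)) := Kernel.ofFunOfCountable fun n =>
  volPos.withDensity fun x => ENNReal.ofReal (poissonWeight n x)

/-- Passes from the subtype to an integral over a subset of ℝ, where the substitution x ↦ a x is
available. -/
theorem lintegral_gammaKernel (n : ℕ) {g : ℝ → ENNReal} (hg : Measurable g) :
    ∫⁻ x, g x ∂(gammaKernel n) =
      ∫⁻ x in Set.Ioi (0 : ℝ), ENNReal.ofReal (poissonWeight n x) * g x := by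
  have h := lintegral_withDensity_eq_lintegral_mul volPos
    (f := fun x : Set.Ioi (0 : ℝ) => ENNReal.ofReal (poissonWeight n x))
    ((measurable_poissonWeight n).ennreal_ofReal.comp measurable_subtype_coe)
    (hg.comp measurable_subtype_coe)
  refine h.trans ?_
  rw [← lintegral_subtype_comap measurableSet_Ioi]
  rfl

theorem gammaKernel_real (n : ℕ) {B : Set (Set.Ioi (0 : ℝ))} (hB : MeasurableSet B) :
    (gammaKernel n).real B = ∫ x in B, poissonWeight n x ∂volPos := by
  have h0 : 0 ≤ ∫ x in B, poissonWeight n x ∂volPos :=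
    integral_nonneg fun s => poissonWeight_nonneg n s
  have : gammaKernel n B = ENNReal.ofReal (∫ x in B, poissonWeight n x ∂volPos) := by
    rw [ofReal_integral_eq_lintegral_ofReal (integrable_poissonWeight n).restrict
      (Filter.Eventually.of_forall fun x => poissonWeight_nonneg n x)]
    exact withDensity_apply _ hB
  rw [measureReal_def, this, ENNReal.toReal_ofReal h0]

instance : IsMarkovKernel gammaKernel := by
  refine ⟨fun n => ⟨?_⟩⟩
  have h := gammaKernel_real n MeasurableSet.univ
  rw [Measure.restrict_univ, integral_poissonWeight, measureReal_def] at h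
  exact (ENNReal.toReal_eq_one_iff _).1 h

theorem poissonPOVM_eq_diagPOVM (e : HilbertBasis ℕ ℂ H) :
    poissonPOVM e = diagPOVM e gammaKernel := by
  refine eq_diagPOVM e _ fun B hB n => ext_inner_basis e fun k => ?_
  have h1 : poissonPOVM e B =
      weakIntegral (volPos.restrict B) (fun x : Set.Ioi (0 : ℝ) => poissonOp e x) := if_pos hB
  rw [h1, (isWeakIntegral_poissonOp e B (e k) (e n)).2,
    ← (integral_poissonOp e B (e k) (e n)).2.tsum_eq, tsum_eq_single n, gammaKernel_real n hB,
    inner_smul_right]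
  · simp [inner_basis, e.orthonormal.1]
  · intro m hm
    simp [inner_basis, hm]

theorem lintegral_Ioi_comp_mul_left {a : ℝ} (ha : 0 < a) {g : ℝ → ENNReal} (hg : Measurable g) :
    ∫⁻ x in Set.Ioi (0 : ℝ), ENNReal.ofReal a * g (a * x) = ∫⁻ x in Set.Ioi (0 : ℝ), g x := by
  have h := setLIntegral_map (μ := volume) (measurableSet_Ioi (a := (0 : ℝ))) hg
    (measurable_const_mul a)
  rw [Set.preimage_const_mul_Ioi₀ _ ha, zero_div] at h
  rw [lintegral_const_mul _ (f := fun x => g (a * x)) (hg.comp (measurable_const_mul a)), ← h,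
    Real.map_volume_mul_left ha.ne', Measure.restrict_smul, lintegral_smul_measure, smul_eq_mul,
    ← mul_assoc, ← ENNReal.ofReal_mul ha.le, abs_of_pos (inv_pos.2 ha), mul_inv_cancel₀ ha.ne',
    ENNReal.ofReal_one, one_mul]

/-- Gamma-Poisson conjugacy, in the form of Bayes' rule: the joint density of intensity and first
count is the probability of the count times the density of the intensity given the count. The factor
e^{λt} is the Jacobian of x ↦ a x with a = e^{λt}. -/
theorem poissonWeight_mul_poissonWeight {lam t x : ℝ} (h : 0 < lam * t) (hx : 0 < x) (m n : ℕ) :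
    ENNReal.ofReal (poissonWeight n x) *
        poissonMeasure (countMean (Real.exp (lam * t)) x 0) {m} =
      ENNReal.ofReal (qcProb lam t m n) * (ENNReal.ofReal (Real.exp (lam * t)) *
        ENNReal.ofReal (poissonWeight (n + m) (Real.exp (lam * t) * x))) := by
  have ha1 : 0 ≤ Real.exp (lam * t) - 1 := by
    rw [sub_nonneg, Real.one_le_exp_iff]; exact h.le
  have hE : Real.exp (-(lam * t) * ((n : ℝ) + m + 1)) = (Real.exp (lam * t) ^ (n + m + 1))⁻¹ := by
    rw [← Real.exp_nat_mul, ← Real.exp_neg]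
    congr 1
    push_cast
    ring
  rw [poissonMeasure_singleton, ← ENNReal.ofReal_mul (poissonWeight_nonneg n ⟨x, hx⟩),
    ← ENNReal.ofReal_mul (Real.exp_pos _).le, ← ENNReal.ofReal_mul (qcProb_nonneg h m n)]
  congr 1
  have hc : ((n + m).choose m : ℝ) * n.factorial * m.factorial = (n + m).factorial := by
    exact_mod_cast Nat.add_choose_mul_factorial_mul_factorial n m
  have hex : Real.exp (-(Real.exp (lam * t) * x)) =
      Real.exp (-x) * Real.exp (-(x * (Real.exp (lam * t) - 1))) := by
    rw [← Real.exp_add]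
    congr 1
    ring
  rw [countMean, pow_zero, one_mul, Real.coe_toNNReal _ (mul_nonneg hx.le ha1)]
  simp only [poissonWeight, qcProb, hE, hex, ← hc]
  have hn : (n.factorial : ℝ) ≠ 0 := by exact_mod_cast n.factorial_ne_zero
  have hm : (m.factorial : ℝ) ≠ 0 := by exact_mod_cast m.factorial_ne_zero
  have hch : ((n + m).choose m : ℝ) ≠ 0 := by
    exact_mod_cast (Nat.choose_pos (Nat.le_add_left m n)).ne'
  have ha := (Real.exp_pos (lam * t)).ne'
  rw [mul_pow, mul_pow]
  field_simp
  ring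

/-- The Poisson laws, as a kernel in the intensity. -/
def poissonKernel (a : ℝ) : Kernel (Set.Ioi (0 : ℝ)) (ℕ → ℕ) where
  toFun x := poissonLaw a x
  measurable' := (measurable_poissonLaw a).comp measurable_subtype_coe

theorem poissonKernel_apply (a : ℝ) (x : Set.Ioi (0 : ℝ)) : poissonKernel a x = poissonLaw a x :=
  rfl

instance (a : ℝ) : IsMarkovKernel (poissonKernel a) :=
  ⟨fun x => inferInstanceAs (IsProbabilityMeasure (poissonLaw a x))⟩

theorem poissonKernel_comp_gammaKernel_apply (a : ℝ) (n : ℕ) {S : Set (ℕ → ℕ)}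
    (hS : MeasurableSet S) : (poissonKernel a ∘ₖ gammaKernel) n S =
      ∫⁻ x in Set.Ioi (0 : ℝ), ENNReal.ofReal (poissonWeight n x) * poissonLaw a x S := by
  rw [Kernel.comp_apply' _ _ _ hS]
  exact lintegral_gammaKernel n ((Measure.measurable_coe hS).comp (measurable_poissonLaw a))

/-- The one-step recursion for the mixture: split off the first count, apply conjugacy under the
integral, and substitute a x for x. -/
theorem poissonKernel_comp_gammaKernel_shift {lam t : ℝ} (h : 0 < lam * t) (m n : ℕ) {k : ℕ}
    (B : Fin k → Set ℕ) :
    (poissonKernel (Real.exp (lam * t)) ∘ₖ gammaKernel) n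
        {ω | ω 0 = m ∧ ∀ i : Fin k, ω (i + 1) ∈ B i} =
      ENNReal.ofReal (qcProb lam t m n) *
        (poissonKernel (Real.exp (lam * t)) ∘ₖ gammaKernel) (n + m)
          {ω | ∀ i : Fin k, ω i ∈ B i} := by
  have hC : MeasurableSet {ω : ℕ → ℕ | ∀ i : Fin k, ω i ∈ B i} :=
    measurableSet_initialCylinder fun _ => MeasurableSet.of_discrete
  have hG : Measurable fun x => ENNReal.ofReal (poissonWeight (n + m) x) *
      poissonLaw (Real.exp (lam * t)) x {ω | ∀ i : Fin k, ω i ∈ B i} :=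
    (measurable_poissonWeight _).ennreal_ofReal.mul
      ((Measure.measurable_coe hC).comp (measurable_poissonLaw _))
  refine (poissonKernel_comp_gammaKernel_apply _ _
    (measurableSet_zero_eq_and_shift_mem m hC)).trans ?_
  rw [poissonKernel_comp_gammaKernel_apply _ _ hC,
    ← lintegral_Ioi_comp_mul_left (Real.exp_pos (lam * t)) hG,
    ← lintegral_const_mul]
  swap
  · exact (hG.comp (measurable_const_mul _)).const_mul _
  refine setLIntegral_congr_fun measurableSet_Ioi fun x hx => ?_
  refine (congrArg _ (poissonLaw_shift (Real.exp (lam * t)) x m B)).trans ?_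
  rw [← mul_assoc, poissonWeight_mul_poissonWeight h hx]
  ring

/-! ### The intensity is a function of the counts -/

/-- Factorial moments: (n - r)² = n(n - 1) + (1 - 2r) n + r². The sums of n and n(n - 1) reduce to
the total mass after an index shift by 1 and 2, since the omitted terms are 0. -/
theorem hasSum_poisson_variance (r : ℝ) :
    HasSum (fun n : ℕ => Real.exp (-r) * r ^ n / n.factorial * ((n : ℝ) - r) ^ 2) r := by
  have h0 : HasSum (fun n : ℕ => Real.exp (-r) * r ^ n / n.factorial) 1 := by
    have := (NormedSpace.expSeries_div_hasSum_exp r).mul_left (Real.exp (-r))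
    rw [← Real.exp_eq_exp_ℝ, ← Real.exp_add, neg_add_cancel, Real.exp_zero] at this
    simpa only [mul_div_assoc] using this
  have h1 : HasSum (fun n : ℕ => Real.exp (-r) * r ^ n / n.factorial * n) r := by
    have := (hasSum_nat_add_iff (f := fun n : ℕ => Real.exp (-r) * r ^ n / n.factorial * n)
      (g := r) 1).1 ?_
    · simpa using this
    · convert! h0.mul_left r using 1
      · funext n
        rw [Nat.factorial_succ]
        have : (n.factorial : ℝ) ≠ 0 := by exact_mod_cast n.factorial_ne_zero
        push_cast
        field_simp
        ring
      · ring
  have h2 : HasSum (fun n : ℕ => Real.exp (-r) * r ^ n / n.factorial * (n * (n - 1))) (r ^ 2) := by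
    have := (hasSum_nat_add_iff
      (f := fun n : ℕ => Real.exp (-r) * r ^ n / n.factorial * ((n : ℝ) * (n - 1)))
      (g := r ^ 2) 2).1 ?_
    · simpa [Finset.sum_range_succ] using this
    · convert! h0.mul_left (r ^ 2) using 1
      · funext n
        rw [Nat.factorial_succ, Nat.factorial_succ]
        have : (n.factorial : ℝ) ≠ 0 := by exact_mod_cast n.factorial_ne_zero
        push_cast
        rw [show (n : ℝ) + 2 - 1 = n + 1 by ring]
        field_simp
        ring
      · ring
  convert! (h2.add (h1.mul_left (1 - 2 * r))).add (h0.mul_left (r ^ 2)) using 1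
  · funext n
    ring
  · ring

theorem lintegral_poissonMeasure_variance (r : NNReal) :
    ∫⁻ n, ENNReal.ofReal (((n : ℝ) - r) ^ 2) ∂(poissonMeasure r) = r := by
  have h := hasSum_poisson_variance r
  rw [poissonMeasure, lintegral_sum_measure]
  simp only [lintegral_smul_measure, lintegral_dirac, smul_eq_mul]
  refine Eq.trans ?_ ((congrArg ENNReal.ofReal h.tsum_eq).trans ENNReal.ofReal_coe_nnreal)
  rw [ENNReal.ofReal_tsum_of_nonneg (fun n => by positivity) h.summable]
  refine tsum_congr fun n => ?_
  rw [ENNReal.ofReal_mul (by positivity)]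

open Filter Topology in
-- The k-th normalized count has mean x and variance x / ((a - 1) a^k), which is summable. So the
-- sum of squared deviations has finite expectation, is almost surely finite, and its terms tend to
-- 0. Only the marginal laws enter.
theorem ae_tendsto_poissonLaw {a x : ℝ} (ha : 1 < a) (hx : 0 < x) :
    ∀ᵐ ω ∂(poissonLaw a x),
      Tendsto (fun k => (ω k : ℝ) / (a ^ k * (a - 1))) atTop (𝓝 x) := by
  have ha1 : 0 < a - 1 := by linarith
  have hc : ∀ k : ℕ, 0 < a ^ k * (a - 1) := fun k => by positivity
  have hmean : ∀ k, (countMean a x k : ℝ) = x * (a ^ k * (a - 1)) := fun k =>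
    Real.coe_toNNReal _ (mul_pos hx (hc k)).le
  have hmeas : ∀ k : ℕ, Measurable fun ω : ℕ → ℕ =>
      ENNReal.ofReal (((ω k : ℝ) / (a ^ k * (a - 1)) - x) ^ 2) := fun k =>
    (measurable_of_countable fun n : ℕ =>
      ENNReal.ofReal (((n : ℝ) / (a ^ k * (a - 1)) - x) ^ 2)).comp (measurable_pi_apply k)
  have hvar : ∀ k : ℕ, ∫⁻ ω, ENNReal.ofReal (((ω k : ℝ) / (a ^ k * (a - 1)) - x) ^ 2)
      ∂(poissonLaw a x) = ENNReal.ofReal (x / (a - 1) * a⁻¹ ^ k) := fun k => by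
    have h1 := lintegral_map (μ := poissonLaw a x) (g := fun ω : ℕ → ℕ => ω k)
      (f := fun n : ℕ => ENNReal.ofReal (((n : ℝ) / (a ^ k * (a - 1)) - x) ^ 2))
      (measurable_of_countable _) (measurable_pi_apply k)
    rw [← h1, poissonLaw, Measure.infinitePi_map_eval]
    -- Factoring out the squared normalization leaves the Poisson variance about the mean x a^k (a -
    -- 1).
    have h2 : ∀ n : ℕ, ENNReal.ofReal (((n : ℝ) / (a ^ k * (a - 1)) - x) ^ 2) =
        ENNReal.ofReal (((a ^ k * (a - 1)) ^ 2)⁻¹) *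
          ENNReal.ofReal (((n : ℝ) - countMean a x k) ^ 2) := fun n => by
      rw [← ENNReal.ofReal_mul (by positivity), hmean]
      congr 1
      have := (hc k).ne'
      field_simp
    simp only [h2]
    rw [lintegral_const_mul _ (measurable_of_countable _), lintegral_poissonMeasure_variance,
      ← ENNReal.ofReal_coe_nnreal, ← ENNReal.ofReal_mul (by positivity), hmean]
    congr 1
    rw [inv_pow]
    have := (hc k).ne'
    have : a ^ k ≠ 0 := by positivity
    field_simp
  have hfin : ∫⁻ ω, ∑' k : ℕ, ENNReal.ofReal (((ω k : ℝ) / (a ^ k * (a - 1)) - x) ^ 2)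
      ∂(poissonLaw a x) ≠ ⊤ := by
    rw [lintegral_tsum fun k => (hmeas k).aemeasurable]
    simp only [hvar]
    rw [← ENNReal.ofReal_tsum_of_nonneg (fun k => by positivity)
      ((summable_geometric_of_lt_one (by positivity) (inv_lt_one_of_one_lt₀ ha)).mul_left _)]
    exact ENNReal.ofReal_ne_top
  filter_upwards [ae_lt_top (Measurable.tsum hmeas) hfin] with ω hω
  have h1 := ENNReal.tendsto_atTop_zero_of_tsum_ne_top hω.ne
  have h2 := (ENNReal.tendsto_toReal ENNReal.zero_ne_top).comp h1
  have h3 : Tendsto (fun k => ((ω k : ℝ) / (a ^ k * (a - 1)) - x) ^ 2) atTop (𝓝 0) := by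
    refine h2.congr fun k => ?_
    exact ENNReal.toReal_ofReal (sq_nonneg _)
  have h4 : Tendsto (fun k => |(ω k : ℝ) / (a ^ k * (a - 1)) - x|) atTop (𝓝 0) := by
    have := (Real.continuous_sqrt.tendsto 0).comp h3
    rw [Real.sqrt_zero] at this
    exact this.congr fun k => Real.sqrt_sq_eq_abs _
  have h5 := ((tendsto_zero_iff_abs_tendsto_zero _).2 h4).add_const x
  simpa using h5

/-- The asymptotic growth rate of the counts. -/
def growthRate (a : ℝ) (ω : ℕ → ℕ) : ℝ :=
  Filter.limsup (fun k => (ω k : ℝ) / (a ^ k * (a - 1))) Filter.atTop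

theorem measurable_growthRate (a : ℝ) : Measurable (growthRate a) :=
  Measurable.limsup fun k => (measurable_of_countable
    fun n : ℕ => (n : ℝ) / (a ^ k * (a - 1))).comp (measurable_pi_apply k)

open Classical in
/-- The asymptotic growth rate of the counts, with the value `1` if it is not positive. -/
def intensity (a : ℝ) (ω : ℕ → ℕ) : Set.Ioi (0 : ℝ) :=
  ⟨if 0 < growthRate a ω then growthRate a ω else 1, by
    split_ifs with h
    exacts [h, Set.mem_Ioi.2 one_pos]⟩

theorem measurable_intensity (a : ℝ) : Measurable (intensity a) :=
  (Measurable.ite (measurable_growthRate a measurableSet_Ioi) (measurable_growthRate a)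
    measurable_const).subtype_mk

/-- The limit superior equals x almost surely, so the fallback value 1 is irrelevant and the
pushforward is the Dirac measure at x. -/
theorem deterministic_intensity_comp {a : ℝ} (ha : 1 < a) :
    Kernel.deterministic (intensity a) (measurable_intensity a) ∘ₖ poissonKernel a =
      Kernel.id := by
  refine Kernel.ext fun x => ?_
  rw [Kernel.deterministic_comp_eq_map, Kernel.map_apply _ (measurable_intensity a),
    Kernel.id_apply, poissonKernel_apply]
  have h : intensity a =ᵐ[poissonLaw a x] fun _ => x := by
    filter_upwards [ae_tendsto_poissonLaw ha x.2] with ω hω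
    have hr : growthRate a ω = x := hω.limsup_eq
    refine Subtype.ext ?_
    simp only [intensity, hr]
    exact if_pos x.2
  rw [Measure.map_congr h, Measure.map_const, measure_univ, one_smul]

theorem exists_qcInstrument_composition (e : HilbertBasis ℕ ℂ H) {lam t : ℝ} (hlam : 0 < lam)
    (ht : 0 < t) : ∃ E : POVM H (ℕ → ℕ), (qcInstrument e hlam ht).IsInfiniteComposition E ∧
      E.FuzzyEquiv (poissonPOVM e) := by
  have h := mul_pos hlam ht
  have h1 : 1 < Real.exp (lam * t) := Real.one_lt_exp_iff.2 h
  refine ⟨diagPOVM e (poissonKernel (Real.exp (lam * t)) ∘ₖ gammaKernel), ?_, ?_⟩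
  · refine isInfiniteComposition_diagPOVM e (hasSum_qcOp e hlam ht)
      (qcOp_apply_basis e h) (fun m n k _ _ hnk => Nat.add_right_cancel hnk) _ fun m n k B => ?_
    rw [Real.sq_sqrt (qcProb_nonneg h _ _)]
    exact poissonKernel_comp_gammaKernel_shift h m n B
  · rw [poissonPOVM_eq_diagPOVM]
    refine ⟨fuzzier_diagPOVM e _ _ (poissonKernel _) rfl,
      fuzzier_diagPOVM e _ _ (Kernel.deterministic _ (measurable_intensity (Real.exp (lam * t)))) ?_⟩
    -- Recovering the intensity undoes the Poisson kernel, so only the Gamma kernel remains.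
    rw [← Kernel.comp_assoc, deterministic_intensity_comp h1, Kernel.id_comp]

theorem CPInstrument.existsUnique_and_fuzzyEquiv {Ω : Type*} [MeasurableSpace Ω]
    {I : CPInstrument H ℕ} {F : POVM H Ω}
    (h : ∃ E : POVM H (ℕ → ℕ), I.IsInfiniteComposition E ∧ E.FuzzyEquiv F) :
    (∃! E : POVM H (ℕ → ℕ), I.IsInfiniteComposition E) ∧
      ∀ E : POVM H (ℕ → ℕ), I.IsInfiniteComposition E → E.FuzzyEquiv F := by
  obtain ⟨E, hE, hF⟩ := h
  exact ⟨⟨E, hE, fun E' hE' => hE'.unique hE⟩, fun E' hE' => hE'.unique hE ▸ hF⟩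

end

end PhotonMeasurement

theorem theorem5 {H : Type*} [NormedAddCommGroup H] [InnerProductSpace ℂ H] [CompleteSpace H]
    (e : HilbertBasis ℕ ℂ H) (lam t : ℝ) (hlam : 0 < lam) (ht : 0 < t) :
    ((∃! E : POVM H (ℕ → ℕ), (pcInstrument e hlam ht).IsInfiniteComposition E) ∧
      ∀ E : POVM H (ℕ → ℕ), (pcInstrument e hlam ht).IsInfiniteComposition E →
        E.FuzzyEquiv (numberPOVM e)) ∧
    ((∃! E : POVM H (ℕ → ℕ), (qcInstrument e hlam ht).IsInfiniteComposition E) ∧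
      ∀ E : POVM H (ℕ → ℕ), (qcInstrument e hlam ht).IsInfiniteComposition E →
        E.FuzzyEquiv (poissonPOVM e)) := by
  exact ⟨CPInstrument.existsUnique_and_fuzzyEquiv (exists_pcInstrument_composition e hlam ht),
    CPInstrument.existsUnique_and_fuzzyEquiv (exists_qcInstrument_composition e hlam ht)⟩
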